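/- Let $n\ge 1$, $T>0$, let $\sigma\in\mathbb R^{n\times n}$ be symmetric positive definite and let $r\mapsto\sigma_r$, $r\in[0,T]$, be a deterministic measurable function with symmetric positive semidefinite values and $\int_0^T|\sigma_r|^2dr<\infty$. On a probability space let $Z$ be an $n$-dimensional Brownian motion with covariance $\sigma^2$ per unit of time, $W$ a standard $n$-dimensional Brownian motion independent of $Z$, and let the $\mathbb R^n$-valued random variables $(S_0,\beta)$ be independent of $(Z,W)$. Put $\tilde Z_t=Z_t-\beta$, $S_t=S_0+\int_0^t\sigma_r\,dW_r$; let $\mu_t$ be the law of $(\tilde Z_t,S_t)$ on $\mathbb R^n\times\mathbb R^n$, so that $\mu_0$ is the law of $(-\beta,S_0)$, and let $\nu_T=N(0,\sigma^2T)$ be the law of $Z_T$. Let $V:\mathbb R^n\times\mathbb R^n\to\mathbb R$ be continuous, and set $\mathcal S(\tilde z,s,y)=V(y-\tilde z,s)$. Assume that $\mathcal S$ is convex and differentiable in $y$, with $|\mathcal S(\tilde z,s,y)|\le m(y)+N(\tilde z,s)$ and $|\partial_y\mathcal S(\tilde z,s,y)|\le\tilde m(y)+\tilde N(\tilde z,s)$,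 where $m,\tilde m$ have at most polynomial growth and $N,\tilde N\in L^2(\mu_T)$. Assume that Monge–Kantorovich duality holds for the problem $\sup_{\pi\in\Pi(\mu_T,\nu_T)}\int\mathcal S\,d\pi$ over couplings, in the following sense. There are an a.e. differentiable $\Gamma\in L^1(\nu_T)$ with $\int\Gamma\,d\nu_T=0$ and a measurable $\Gamma^c\in L^1(\mu_T)$ such that everywhere $\Gamma(y)=\sup_{\tilde z,s}\{\mathcal S(\tilde z,s,y)-\Gamma^c(\tilde z,s)\}$ and $\Gamma^c(\tilde z,s)=\sup_y\{\mathcal S(\tilde z,s,y)-\Gamma(y)\}$; and there are a measurable map $I:\mathbb R^n\times\mathbb R^n\to\mathbb R^n$ and an optimal coupling $\pi^*\in\Pi(\mu_T,\nu_T)$ with $y=I(\tilde z,s)$ for $\pi^*$-a.e. $(\tilde z,s,y)$ and $\int\mathcal S\,d\pi^*=\int\Gamma^c\,d\mu_T$. Let $y\mapsto\pi^*_y(d\tilde z,ds)$ be the disintegration of $\pi^*$ along $y$. Let $Y$ be an $n$-dimensional Brownian motion on $[0,T]$, $Y_0=0$, with covariance $\sigma^2$ per unit of time, on some probability space, and let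 $\mathcal F^Y$ be its augmented filtration. A solution of the backward stochastic PDE $$d\rho_t=\tfrac12\operatorname{Tr}\big(\sigma^2\partial_{\tilde z\tilde z}\rho_t+\sigma_t^2\partial_{ss}\rho_t\big)dt+R_t\,dY_t\quad(t<T),\qquad \rho_T=\pi^*_{Y_T},$$ is a family $(\rho_t)_{t\in[0,T]}$ of random finite signed measures on $\mathbb R^n\times\mathbb R^n$ with $\rho_T=\pi^*_{Y_T}$ a.s., together with, for every $\varphi\in C_b^\infty(\mathbb R^{2n})$ (smooth, bounded, with all derivatives bounded), an $\mathcal F^Y$-progressively measurable process $R^\varphi$ with $\mathbb E\int_0^T|R^\varphi_r|^2dr<\infty$, such that for every such $\varphi$ the process $\langle\rho_t,\varphi\rangle$ is $\mathcal F^Y$-progressively measurable and, with $L_r\varphi=\frac12\operatorname{Tr}(\sigma^2\partial_{\tilde z\tilde z}\varphi+\sigma_r^2\partial_{ss}\varphi)$, one has $\int_0^T|\langle\rho_r,L_r\varphi\rangle|dr<\infty$ a.s. and, for every $t\in[0,T]$, $$\langle\rho_T,\varphi\rangle-\langle\rho_t,\varphi\rangle=\int_t^T\langle\rho_r,L_r\varphi\rangle\,dr+\int_t^TR^\varphi_r\cdot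 dY_r\quad\text{a.s.}$$ **Proposition.** If this backward stochastic PDE admits a solution for some such $Y$, and if $\mu_0$ has a $C^\infty$ density with respect to Lebesgue measure, then, after modification on a $\mu_T$-null set, $\tilde z\mapsto I(\tilde z,s)$ is $C^\infty$ for every $s$: there is a measurable $J:\mathbb R^n\times\mathbb R^n\to\mathbb R^n$ with $I=J$ $\mu_T$-a.e. such that $\tilde z\mapsto J(\tilde z,s)$ is $C^\infty$ on $\mathbb R^n$ for every $s\in\mathbb R^n$. -/

import Mathlib

open MeasureTheory ProbabilityTheory Filter Topology Set
open scoped RealInnerProductSpace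

noncomputable section

namespace Kyle

/-- The space `ℝⁿ` with its Euclidean norm. -/
abbrev E (n : ℕ) : Type := EuclideanSpace ℝ (Fin n)

/-! ### Brownian motion, filtrations, stochastic integrals -/

section Stochastic

variable {Ω : Type*} [mΩ : MeasurableSpace Ω] {n : ℕ}

/-- `B` is an `n`-dimensional Brownian motion on `[0, T]` started at `0`, with covariance matrix
`C` per unit of time. Values at times outside `[0, T]` are irrelevant. -/
structure IsBrownianMotion (P : Measure Ω) (T : ℝ) (C : Matrix (Fin n) (Fin n) ℝ)
    (B : ℝ → Ω → E n) : Prop where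
  start : ∀ᵐ ω ∂P, B 0 ω = 0
  continuousOn : ∀ᵐ ω ∂P, ContinuousOn (fun t => B t ω) (Icc 0 T)
  indep_increments : HasIndepIncrements (fun t : Icc (0 : ℝ) T => B t) P
  gaussian_increments : ∀ s t : ℝ, 0 ≤ s → s ≤ t → t ≤ T →
    P.map (fun ω => B t ω - B s ω) = multivariateGaussian 0 ((t - s) • C)

/-- The augmentation by null events of the filtration generated by `(B t)_{t ≥ 0}`. -/
def augmentedFiltration (P : Measure Ω) (B : ℝ → Ω → E n) (hB : ∀ t, Measurable (B t)) :
    Filtration ℝ mΩ where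
  seq t := (⨆ s ∈ Icc (0 : ℝ) t, MeasurableSpace.comap (B s) inferInstance) ⊔
    MeasurableSpace.generateFrom {A | MeasurableSet A ∧ P A = 0}
  mono' _ _ h := sup_le_sup_right (biSup_mono fun _ hs => ⟨hs.1, hs.2.trans h⟩) _
  le' _ := sup_le (iSup₂_le fun s _ => (hB s).comap_le)
    (MeasurableSpace.generateFrom_le fun _ hA => hA.1)

/-- `u` is progressively measurable on the time interval `[0, T]`. -/
def ProgressiveOn {F : Type*} [TopologicalSpace F] (ℱ : Filtration ℝ mΩ) (T : ℝ)
    (u : ℝ → Ω → F) : Prop :=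
  ∀ t ∈ Icc (0 : ℝ) T,
    StronglyMeasurable[Subtype.instMeasurableSpace.prod (ℱ t)]
      (fun p : Icc (0 : ℝ) t × Ω => u p.1 p.2)

/-- Simple predictable integrands `∑_{i < N} ξ i · 1_{(τ i, τ (i + 1)]}`, each `ξ i` bounded and
`ℱ (τ i)`-measurable. -/
structure SimpleIntegrand (ℱ : Filtration ℝ mΩ) (n : ℕ) where
  /-- number of steps -/
  N : ℕ
  /-- grid -/
  τ : ℕ → ℝ
  /-- values -/
  ξ : ℕ → Ω → E n
  nonneg : 0 ≤ τ 0
  mono : Monotone τ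
  meas : ∀ i, StronglyMeasurable[ℱ (τ i)] (ξ i)
  bdd : ∀ i, ∃ K : ℝ, ∀ ω, ‖ξ i ω‖ ≤ K

/-- The process defined by a simple integrand. -/
def SimpleIntegrand.val {ℱ : Filtration ℝ mΩ} (H : SimpleIntegrand ℱ n) (t : ℝ) (ω : Ω) : E n :=
  ∑ i ∈ Finset.range H.N, (Ioc (H.τ i) (H.τ (i + 1))).indicator (fun _ => H.ξ i ω) t

/-- The elementary stochastic integral `∫₀ᵗ H · dB` of a simple integrand. -/
def SimpleIntegrand.integral {ℱ : Filtration ℝ mΩ} (H : SimpleIntegrand ℱ n) (B : ℝ → Ω → E n)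
    (t : ℝ) (ω : Ω) : ℝ :=
  ∑ i ∈ Finset.range H.N, ⟪H.ξ i ω, B (min (H.τ (i + 1)) t) ω - B (min (H.τ i) t) ω⟫

/-- `M t = ∫₀ᵗ R · dB` almost surely for every `t ∈ [0, T]`: the Itô integral of the progressively
measurable, square-integrable `ℝⁿ`-valued process `R`, i.e. the `L²` limit of the elementary
integrals of simple integrands that approximate `R` in `L²([0, T] × Ω)`. -/
structure IsItoIntegral (P : Measure Ω) (ℱ : Filtration ℝ mΩ) (T : ℝ) (B : ℝ → Ω → E n)
    (R : ℝ → Ω → E n) (M : ℝ → Ω → ℝ) : Prop where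
  progressive : ProgressiveOn ℱ T R
  memLp : MemLp (fun p : ℝ × Ω => R p.1 p.2) 2 ((volume.restrict (Icc 0 T)).prod P)
  memLp_integral : ∀ t ∈ Icc (0 : ℝ) T, MemLp (M t) 2 P
  approx : ∃ H : ℕ → SimpleIntegrand ℱ n,
    Tendsto (fun k => eLpNorm (fun p : ℝ × Ω => (H k).val p.1 p.2 - R p.1 p.2) 2
      ((volume.restrict (Icc 0 T)).prod P)) atTop (𝓝 0) ∧
    ∀ t ∈ Icc (0 : ℝ) T,
      Tendsto (fun k => eLpNorm (fun ω => (H k).integral B t ω - M t ω) 2 P) atTop (𝓝 0)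

end Stochastic

/-! ### The market -/

section Market

variable {Ω : Type*} [mΩ : MeasurableSpace Ω] {n : ℕ}

/-- The standing assumptions on the market: `σ` is symmetric positive definite, `σt` is a
deterministic, square-integrable, symmetric positive semidefinite matrix-valued function, `Z` is a
`σ²`-Brownian motion, `W` a standard Brownian motion, `Z`, `W` and `(S₀, β)` are independent, and
`S t = S₀ + ∫₀ᵗ σt r dW_r`. -/
structure IsMarket (P : Measure Ω) (T : ℝ) (σ : Matrix (Fin n) (Fin n) ℝ)
    (σt : ℝ → Matrix (Fin n) (Fin n) ℝ) (Z W S : ℝ → Ω → E n) (β : Ω → E n) : Prop where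
  vol_posDef : σ.PosDef
  signal_posSemidef : ∀ r ∈ Icc (0 : ℝ) T, (σt r).PosSemidef
  signal_memLp : ∀ i j, MemLp (fun r => σt r i j) 2 (volume.restrict (Icc 0 T))
  measurable_Z : ∀ t, Measurable (Z t)
  measurable_W : ∀ t, Measurable (W t)
  measurable_S_zero : Measurable (S 0)
  measurable_β : Measurable β
  brownian_Z : IsBrownianMotion P T (σ * σ) Z
  brownian_W : IsBrownianMotion P T 1 W
  indep_Z_W : IndepFun (fun ω (t : Icc (0 : ℝ) T) => Z t ω)
    (fun ω (t : Icc (0 : ℝ) T) => W t ω) P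
  indep_initial : IndepFun (fun ω => (S 0 ω, β ω))
    (fun ω => ((fun t : Icc (0 : ℝ) T => Z t ω), (fun t : Icc (0 : ℝ) T => W t ω))) P
  signal_eq : ∀ i, IsItoIntegral P (augmentedFiltration P W measurable_W) T W
    (fun r _ => WithLp.toLp 2 (σt r i)) (fun t ω => S t ω i - S 0 ω i)

/-- The law `μ_t` of `(Z_t - β, S_t)`. -/
def stateLaw (P : Measure Ω) (Z S : ℝ → Ω → E n) (β : Ω → E n) (t : ℝ) : Measure (E n × E n) :=
  P.map (fun ω => (Z t ω - β ω, S t ω))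

/-- `μ` has a `C^∞` density with respect to Lebesgue measure. -/
def HasSmoothDensity (μ : Measure (E n × E n)) : Prop :=
  ∃ f : E n × E n → ℝ, ContDiff ℝ (⊤ : ℕ∞) f ∧ (∀ x, 0 ≤ f x) ∧
    μ = volume.withDensity (fun x => ENNReal.ofReal (f x))

end Market

/-! ### The optimal transport problem -/

section Transport

variable {n : ℕ}

/-- The surplus function `𝒮(z, s, y) = V(y - z, s)`. -/
def surplus (V : E n × E n → ℝ) (x : E n × E n) (y : E n) : ℝ := V (y - x.1, x.2)

/-- The set `Π(μ, ν)` of couplings. -/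
def couplings (μ : Measure (E n × E n)) (ν : Measure (E n)) : Set (Measure ((E n × E n) × E n)) :=
  {π | π.map Prod.fst = μ ∧ π.map Prod.snd = ν}

/-- At most polynomial growth. -/
def PolynomialGrowth (m : E n → ℝ) : Prop :=
  ∃ (K : ℝ) (k : ℕ), ∀ y, |m y| ≤ K * (1 + ‖y‖) ^ k

/-- The standing assumption on the transport problem
`sup_{π ∈ Π(μ, ν)} ∫ V(y - z, s) dπ`: regularity and growth of the surplus, Monge–Kantorovich
duality with potentials `Γ`, `Γc`, and an optimal coupling `π` which is concentrated on the graph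
of the transport map `y = I(z, s)`. -/
structure IsOptimalTransport (V : E n × E n → ℝ) (μ : Measure (E n × E n)) (ν : Measure (E n))
    (Γ : E n → ℝ) (Γc : E n × E n → ℝ) (I : E n × E n → E n)
    (π : Measure ((E n × E n) × E n)) : Prop where
  continuous_V : Continuous V
  convex : ∀ x, ConvexOn ℝ univ (surplus V x)
  differentiable : ∀ x, Differentiable ℝ (surplus V x)
  bound : ∃ (m : E n → ℝ) (N : E n × E n → ℝ), PolynomialGrowth m ∧ MemLp N 2 μ ∧
    ∀ x y, |surplus V x y| ≤ m y + N x
  bound_deriv : ∃ (m : E n → ℝ) (N : E n × E n → ℝ), PolynomialGrowth m ∧ MemLp N 2 μ ∧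
    ∀ x y, ‖fderiv ℝ (surplus V x) y‖ ≤ m y + N x
  differentiable_potential : ∀ᵐ y : E n, DifferentiableAt ℝ Γ y
  measurable_conj : Measurable Γc
  measurable_map : Measurable I
  integrable_potential : Integrable Γ ν
  integral_potential : ∫ y, Γ y ∂ν = 0
  integrable_conj : Integrable Γc μ
  potential_eq : ∀ y, IsLUB (range fun x => surplus V x y - Γc x) (Γ y)
  conj_eq : ∀ x, IsLUB (range fun y => surplus V x y - Γ y) (Γc x)
  coupling : π ∈ couplings μ ν
  graph : ∀ᵐ p ∂π, p.2 = I p.1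
  optimal : ∀ π' ∈ couplings μ ν, ∫ p, surplus V p.1 p.2 ∂π' ≤ ∫ p, surplus V p.1 p.2 ∂π
  duality : ∫ p, surplus V p.1 p.2 ∂π = ∫ x, Γc x ∂μ

/-- The disintegration `y ↦ π_y(dz, ds)` of `π` along its last coordinate. -/
def disintegration (π : Measure ((E n × E n) × E n)) [IsFiniteMeasure π] :
    Kernel (E n) (E n × E n) :=
  (π.map Prod.swap).condKernel

instance (π : Measure ((E n × E n) × E n)) [IsFiniteMeasure π] :
    IsMarkovKernel (disintegration π) := by
  unfold disintegration; infer_instance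

end Transport

/-! ### The backward stochastic partial differential equation -/

section BSPDE

variable {Ω : Type*} [mΩ : MeasurableSpace Ω] {n : ℕ}

/-- Test functions: smooth, bounded, with bounded derivatives of all orders. -/
def IsTestFunction (φ : E n × E n → ℝ) : Prop :=
  ContDiff ℝ (⊤ : ℕ∞) φ ∧ ∀ k : ℕ, ∃ K : ℝ, ∀ x, ‖iteratedFDeriv ℝ k φ x‖ ≤ K

/-- The pairing `∫ φ dm` of a function with a (finite) signed measure. -/
def pairing (m : SignedMeasure (E n × E n)) (φ : E n × E n → ℝ) : ℝ :=
  m.integral φ (ContinuousLinearMap.lsmul ℝ ℝ)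

/-- The operator `½ Tr(A ∂_{zz} φ + C ∂_{ss} φ)`; it is its own formal adjoint. -/
def generator (A C : Matrix (Fin n) (Fin n) ℝ) (φ : E n × E n → ℝ) (x : E n × E n) : ℝ :=
  (1 / 2) * ∑ i, ∑ j,
    (A i j * iteratedFDeriv ℝ 2 φ x
        ![(EuclideanSpace.single i 1, 0), (EuclideanSpace.single j 1, 0)] +
      C i j * iteratedFDeriv ℝ 2 φ x
        ![(0, EuclideanSpace.single i 1), (0, EuclideanSpace.single j 1)])

/-- `(ρ, R)` is a (weak, measure-valued, not necessarily nonnegative) adapted solution of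
`dρ_t = ½ Tr(σ² ∂_{zz} ρ_t + (σt t)² ∂_{ss} ρ_t) dt + R_t dY_t`, with terminal condition
`ρ_T = κ(Y_T)`, where adaptedness refers to the filtration `ℱ`. The coefficient `R_t` is a
generalized function of `(z, s)` given by its pairings `R φ t` with the test functions `φ`, which
are square-integrable processes. -/
structure IsBSPDESolution (P : Measure Ω) (ℱ : Filtration ℝ mΩ) (T : ℝ)
    (σ : Matrix (Fin n) (Fin n) ℝ) (σt : ℝ → Matrix (Fin n) (Fin n) ℝ) (Y : ℝ → Ω → E n)
    (κ : Kernel (E n) (E n × E n)) [IsMarkovKernel κ]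
    (ρ : ℝ → Ω → SignedMeasure (E n × E n))
    (R : (E n × E n → ℝ) → ℝ → Ω → E n) : Prop where
  terminal : ∀ᵐ ω ∂P, ρ T ω = (κ (Y T ω)).toSignedMeasure
  progressive : ∀ φ, IsTestFunction φ → ProgressiveOn ℱ T (fun t ω => pairing (ρ t ω) φ)
  integrable_drift : ∀ φ, IsTestFunction φ → ∀ᵐ ω ∂P,
    IntervalIntegrable
      (fun r => pairing (ρ r ω) (generator (σ * σ) (σt r * σt r) φ)) volume 0 T
  equation : ∀ φ, IsTestFunction φ → ∃ M : ℝ → Ω → ℝ, IsItoIntegral P ℱ T Y (R φ) M ∧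
    ∀ t ∈ Icc (0 : ℝ) T, ∀ᵐ ω ∂P,
      pairing (ρ T ω) φ - pairing (ρ t ω) φ =
        (∫ r in t..T, pairing (ρ r ω) (generator (σ * σ) (σt r * σt r) φ)) +
          (M T ω - M t ω)

end BSPDE

end Kyle

end

/-!
The transport map is read off from a time `t < T`. Write `κ_y` for the disintegration of the optimal
coupling `π` along `y`, and `m_y` for the average of `κ` against `N(y, (T - t) σ²)`, the law of
`Y_T` given `Y_t = y`. Of the transport problem the argument uses that `π` has the marginals `μ_T`,
`ν_T` and is concentrated on the graph of `I`.

*Deconvolution.* Testing the backward equation against `cos ∘ L` and `sin ∘ L`, `L` a linear form,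
gives a scalar linear backward equation with a martingale part, because these functions are
eigenfunctions of the generator. By variation of constants, `⟨ρ_t, f ∘ L⟩` is an exponential factor
times the conditional expectation of its terminal value. In terms of characteristic functions:
for almost every `ω`, the convolution of the signed measure `ρ_t` with a Gaussian law is `m_{Y_t}`
(`IsBSPDESolution.conv_eq`). Hence, for `y` in a set that carries the law of `Y_t`, the measure
`m_y` is a difference of finite measures smoothed by `N(0, (T - t) σ²)` in the variable `z`.

*Densities.* As `π` sits on a graph, `m_y` has the density `w_y ∘ I` with respect to `μ_T`, where
`w_y` is the likelihood ratio between `N(y, (T - t) σ²)` and `N(0, T σ²)`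
(`disintegration_comp_withDensity`, `map_add_multivariateGaussian`). Also `μ_T` is smoothed by
`N(0, T σ²)` in `z`, since `Z_T` is independent of `(β, S_T)` (`IsMarket.exists_stateLaw_eq_conv`).
With respect to a common reference measure `dz ⊗ λ(ds)`, all these measures have densities which,
for every `s`, are smooth in `z` and analytic along lines (`exists_smooth_densities`). So, for
`λ`-almost every `s`, the density `q` of `μ_T` and the densities `g_y` of the `m_y` satisfy
`g_y = (w_y ∘ I) q` for almost every `z`.

*Positivity.* Choose `y_0, …, y_n`, the vertices of a simplex, as is possible because `Y_t` has an
absolutely continuous law (`exists_basis_sub_of_ae`). The quotients `log (g_{y_i} / g_{y_0})` are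
affine functions of `I` and determine it. Where all `g_{y_i}` are positive, `I` thus has a smooth
version, and `log (g_{y_0} / q)` is a quadratic function of it with negative definite leading part.
The `g_{y_i}` cannot vanish anywhere: approaching a zero along a line, their logarithms diverge at
logarithmic rates given by the orders of vanishing. If two orders differed, `I` would diverge at
that rate and `log (g_{y_0} / q)` like its square, which is too fast; if all orders are equal, `I`
stays bounded, so `log (g_{y_0} / q)` is bounded and the common order is zero
(`pos_and_eq_decode_of_ae_eq`). Solving for `I` in terms of the quotients gives the smooth version
(`exists_smooth_version`).
-/

noncomputable section

namespace Kyle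

/-! ### Plane waves as test functions -/

section Waves

variable {n : ℕ}

theorem isTestFunction_comp_dual {f : ℝ → ℝ} (hf : ContDiff ℝ (⊤ : ℕ∞) f)
    (hb : ∀ k x, |iteratedDeriv k f x| ≤ 1) (L : StrongDual ℝ (E n × E n)) :
    IsTestFunction (fun x => f (L x)) := by
  refine ⟨hf.comp L.contDiff, fun k => ⟨1 * ∏ _i : Fin k, ‖L‖, fun x => ?_⟩⟩
  have h := L.iteratedFDeriv_comp_right (n := (⊤ : ℕ∞)) hf x (i := k) (by exact_mod_cast le_top)
  have h' : (fun x => f (L x)) = f ∘ L := rfl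
  rw [h', h]
  refine (ContinuousMultilinearMap.norm_compContinuousLinearMap_le _ _).trans ?_
  gcongr
  rw [norm_iteratedFDeriv_eq_norm_iteratedDeriv]
  exact hb k _

/-- The quadratic form associated with `½ Tr(A ∂_{zz} + C ∂_{ss})`, evaluated at a covector: minus
the Fourier multiplier of `generator A C`. -/
def symbol (A C : Matrix (Fin n) (Fin n) ℝ) (L : StrongDual ℝ (E n × E n)) : ℝ :=
  (1 / 2) * ∑ i, ∑ j,
    (A i j * (L (EuclideanSpace.single i 1, 0) * L (EuclideanSpace.single j 1, 0)) +
      C i j * (L (0, EuclideanSpace.single i 1) * L (0, EuclideanSpace.single j 1)))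

/-- Plane waves are eigenfunctions of the generator. -/
theorem generator_comp_dual {f : ℝ → ℝ} (hf : ContDiff ℝ (⊤ : ℕ∞) f)
    (h2 : ∀ x, iteratedDeriv 2 f x = -f x) (A C : Matrix (Fin n) (Fin n) ℝ)
    (L : StrongDual ℝ (E n × E n)) (x : E n × E n) :
    generator A C (fun x => f (L x)) x = -symbol A C L * f (L x) := by
  have h : ∀ v w : E n × E n,
      iteratedFDeriv ℝ 2 (fun x => f (L x)) x ![v, w] = L v * L w * -f (L x) := by
    intro v w
    have h := L.iteratedFDeriv_comp_right (n := (⊤ : ℕ∞)) hf x (i := 2)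
      (WithTop.coe_le_coe.2 (le_top : (2 : ℕ∞) ≤ ⊤))
    have h' : (fun x => f (L x)) = f ∘ L := rfl
    rw [h', h, ContinuousMultilinearMap.compContinuousLinearMap_apply,
      iteratedFDeriv_apply_eq_iteratedDeriv_mul_prod, h2]
    simp [Fin.prod_univ_two]
  simp only [generator, symbol, h]
  rw [neg_mul, mul_assoc, ← mul_neg, Finset.sum_mul, ← Finset.sum_neg_distrib]
  congr 1
  refine Finset.sum_congr rfl fun i _ => ?_
  rw [Finset.sum_mul, ← Finset.sum_neg_distrib]
  refine Finset.sum_congr rfl fun j _ => ?_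
  ring

instance (m : SignedMeasure (E n × E n)) : IsFiniteMeasure m.variation := by
  rw [← SignedMeasure.totalVariation_eq_variation]
  unfold SignedMeasure.totalVariation
  infer_instance

theorem integrable_of_isTestFunction (μ : Measure (E n × E n)) [IsFiniteMeasure μ]
    {φ : E n × E n → ℝ} (hφ : IsTestFunction φ) : Integrable φ μ := by
  obtain ⟨K, hK⟩ := hφ.2 0
  exact Integrable.of_bound hφ.1.continuous.aestronglyMeasurable K
    (ae_of_all _ fun x => by simpa using hK x)

theorem pairing_toSignedMeasure (μ : Measure (E n × E n)) [IsFiniteMeasure μ]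
    (φ : E n × E n → ℝ) : pairing μ.toSignedMeasure φ = ∫ x, φ x ∂μ := by
  have h : (ContinuousLinearMap.lsmul ℝ ℝ : ℝ →L[ℝ] ℝ →L[ℝ] ℝ) =
      (ContinuousLinearMap.lsmul ℝ ℝ : ℝ →L[ℝ] ℝ →L[ℝ] ℝ).flip := by
    ext; simp
  rw [pairing, h]
  exact VectorMeasure.integral_toSignedMeasure

theorem pairing_const_mul (m : SignedMeasure (E n × E n)) (c : ℝ) (φ : E n × E n → ℝ) :
    pairing m (fun x => c * φ x) = c * pairing m φ :=
  VectorMeasure.integral_fun_smul m _ c φ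

/-- The pairing with a signed measure is the difference of the integrals against its Jordan
parts. -/
theorem pairing_eq_sub (m : SignedMeasure (E n × E n)) {φ : E n × E n → ℝ}
    (hφ : IsTestFunction φ) :
    pairing m φ = ∫ x, φ x ∂m.toJordanDecomposition.posPart -
      ∫ x, φ x ∂m.toJordanDecomposition.negPart := by
  have h := m.toSignedMeasure_toJordanDecomposition
  conv_lhs => rw [← h, JordanDecomposition.toSignedMeasure]
  rw [pairing, VectorMeasure.integral_sub_vectorMeasure
    (integrable_of_isTestFunction _ hφ) (integrable_of_isTestFunction _ hφ)]
  exact congrArg₂ (· - ·) (pairing_toSignedMeasure _ φ) (pairing_toSignedMeasure _ φ)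

end Waves

/-! ### Variation of constants with an integrable coefficient -/

section LinearEquation

theorem absolutelyContinuousOnInterval_exp {f : ℝ → ℝ} {a b : ℝ}
    (hf : AbsolutelyContinuousOnInterval f a b) :
    AbsolutelyContinuousOnInterval (fun x => Real.exp (f x)) a b := by
  obtain ⟨C, hC⟩ := hf.exists_bound
  have key : ∀ x ∈ uIcc a b, ∀ y ∈ uIcc a b,
      dist (Real.exp (f x)) (Real.exp (f y)) ≤ Real.exp C * dist (f x) (f y) := by
    intro x hx y hy
    have h := (convex_Icc (-C) C).norm_image_sub_le_of_norm_deriv_le (f := Real.exp)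
      (C := Real.exp C) (x := f y) (y := f x) (fun z _ => Real.differentiableAt_exp)
      (fun z hz => by
        rw [Real.deriv_exp, Real.norm_eq_abs, Real.abs_exp]
        exact Real.exp_le_exp.2 hz.2)
      (abs_le.1 (hC y hy)) (abs_le.1 (hC x hx))
    simpa [Real.dist_eq] using h
  have h0 := Tendsto.const_mul (Real.exp C) hf
  rw [mul_zero] at h0
  refine tendsto_of_tendsto_of_tendsto_of_le_of_le' tendsto_const_nhds h0
    (Eventually.of_forall fun _ => Finset.sum_nonneg fun _ _ => dist_nonneg) ?_
  filter_upwards [mem_inf_of_right (mem_principal_self _)] with I hI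
  rw [Finset.mul_sum]
  exact Finset.sum_le_sum fun i hi => key _ (hI.1 i hi).1 _ (hI.1 i hi).2

/-- Variation of constants for the linear integral equation with a merely integrable coefficient
`q`, in integrated form: `F r = ∫_r^T q x` solves `F' = -q F - q (x - F)`. -/
theorem integral_variation_of_constants {q x : ℝ → ℝ} {t T : ℝ}
    (hq : IntervalIntegrable q volume t T)
    (hqx : IntervalIntegrable (fun r => q r * x r) volume t T) :
    ∫ r in t..T, q r * (x r - ∫ v in r..T, q v * x v) * Real.exp (-∫ v in r..T, q v) =
      (∫ v in t..T, q v * x v) * Real.exp (-∫ v in t..T, q v) := by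
  have hT : T ∈ uIcc t T := right_mem_uIcc
  have e1 : ∀ (g : ℝ → ℝ) r, ∫ v in r..T, g v = -∫ v in T..r, g v := fun g r =>
    intervalIntegral.integral_symm _ _
  have hF : AbsolutelyContinuousOnInterval (fun r => ∫ v in r..T, q v * x v) t T := by
    have := (hqx.absolutelyContinuousOnInterval_intervalIntegral hT).neg
    refine (congrArg (fun f => AbsolutelyContinuousOnInterval f t T) ?_).mp this
    funext r; simp [e1]
  have hQ : AbsolutelyContinuousOnInterval (fun r => -∫ v in r..T, q v) t T := by
    have := (hq.absolutelyContinuousOnInterval_intervalIntegral hT)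
    refine (congrArg (fun f => AbsolutelyContinuousOnInterval f t T) ?_).mp this
    funext r; simp [e1]
  have hG := absolutelyContinuousOnInterval_exp hQ
  have h := hF.integral_deriv_mul_eq_sub hG
  simp only [intervalIntegral.integral_same, zero_mul, zero_sub] at h
  rw [← neg_eq_iff_eq_neg] at h
  rw [← h, ← intervalIntegral.integral_neg]
  apply intervalIntegral.integral_congr_ae
  filter_upwards [hq.ae_hasDerivAt_integral, hqx.ae_hasDerivAt_integral] with r h1 h2 hr
  have hr' := uIoc_subset_uIcc hr
  have d1 : HasDerivAt (fun r => ∫ v in r..T, q v * x v) (-(q r * x r)) r := by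
    have := (h2 hr' T hT).neg
    refine this.congr_of_eventuallyEq (Eventually.of_forall fun s => by simp [e1])
  have d2 : HasDerivAt (fun r => -∫ v in r..T, q v) (q r) r :=
    (h1 hr' T hT).congr_of_eventuallyEq (Eventually.of_forall fun s => by simp [e1])
  rw [d1.deriv, d2.exp.deriv]
  ring

theorem integral_mul_exp_neg_integral {q : ℝ → ℝ} {t T : ℝ}
    (hq : IntervalIntegrable q volume t T) :
    ∫ r in t..T, q r * Real.exp (-∫ v in r..T, q v) = 1 - Real.exp (-∫ v in t..T, q v) := by
  have hT : T ∈ uIcc t T := right_mem_uIcc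
  have e1 : ∀ (g : ℝ → ℝ) r, ∫ v in r..T, g v = -∫ v in T..r, g v := fun g r =>
    intervalIntegral.integral_symm _ _
  have hQ : AbsolutelyContinuousOnInterval (fun r => -∫ v in r..T, q v) t T := by
    have := (hq.absolutelyContinuousOnInterval_intervalIntegral hT)
    refine (congrArg (fun f => AbsolutelyContinuousOnInterval f t T) ?_).mp this
    funext r; simp [e1]
  have h := (absolutelyContinuousOnInterval_exp hQ).integral_deriv_eq_sub
  simp only [intervalIntegral.integral_same, neg_zero, Real.exp_zero] at h
  rw [← h]
  apply intervalIntegral.integral_congr_ae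
  filter_upwards [hq.ae_hasDerivAt_integral] with r h1 hr
  have d2 : HasDerivAt (fun r => -∫ v in r..T, q v) (q r) r :=
    (h1 (uIoc_subset_uIcc hr) T hT).congr_of_eventuallyEq
      (Eventually.of_forall fun s => by simp [e1])
  rw [d2.exp.deriv]
  ring

end LinearEquation

/-! ### Brownian filtrations and null events -/

section BrownianFiltration

theorem iSup_comap_Icc_eq {Ω : Type*} {n : ℕ} (B : ℝ → Ω → E n) (t : ℝ) :
    (⨆ s ∈ Icc (0 : ℝ) t, MeasurableSpace.comap (B s) inferInstance) =
      MeasurableSpace.comap (fun ω (s : Icc (0 : ℝ) t) => B s ω) MeasurableSpace.pi := by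
  have h := MeasurableSpace.comap_iSup (g := fun ω (s : Icc (0 : ℝ) t) => B s ω)
    (m := fun s : Icc (0 : ℝ) t => MeasurableSpace.comap (fun f : Icc (0 : ℝ) t → E n => f s)
      inferInstance)
  rw [iSup_subtype']
  refine Eq.trans ?_ h.symm
  simp only [MeasurableSpace.comap_comp]
  rfl

variable {Ω : Type*} [mΩ : MeasurableSpace Ω] {n : ℕ}

/-- Adjoining null events to a σ-algebra only adds events that agree almost surely with an event
of the original one. -/
theorem exists_ae_eq_of_measurableSet_sup_null {P : Measure Ω} (m : MeasurableSpace Ω) {A : Set Ω}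
    (hA : MeasurableSet[m ⊔ MeasurableSpace.generateFrom {A | MeasurableSet[mΩ] A ∧ P A = 0}] A) :
    ∃ A', MeasurableSet[m] A' ∧ A =ᵐ[P] A' := by
  have h : m ⊔ MeasurableSpace.generateFrom {A | MeasurableSet[mΩ] A ∧ P A = 0} ≤
      eventuallyMeasurableSpace m (ae P) := by
    refine sup_le (fun B hB => ⟨B, hB, ae_eq_refl B⟩) (MeasurableSpace.generateFrom_le ?_)
    rintro B ⟨-, hB⟩
    exact ⟨∅, @MeasurableSet.empty _ m, ae_eq_empty.2 hB⟩
  exact h A hA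

theorem indep_sup_null {P : Measure Ω} {m₁ m₂ : MeasurableSpace Ω}
    (h : Indep (_mΩ := mΩ) m₁ m₂ P) :
    Indep (m₁ ⊔ MeasurableSpace.generateFrom {A | MeasurableSet[mΩ] A ∧ P A = 0}) m₂ P := by
  rw [Indep_iff] at h ⊢
  intro A B hA hB
  obtain ⟨A', hA', hAA'⟩ := exists_ae_eq_of_measurableSet_sup_null (mΩ := mΩ) m₁ hA
  rw [measure_congr (hAA'.inter (ae_eq_refl B)), measure_congr hAA', h A' B hA' hB]

variable {P : Measure Ω} {T : ℝ} {C : Matrix (Fin n) (Fin n) ℝ} {B : ℝ → Ω → E n}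

/-- Joint Gaussianity reduces the independence of an increment from the whole past to the
vanishing of covariances. -/
theorem IsBrownianMotion.isGaussian (h : IsBrownianMotion P T C B) (hT : 0 ≤ T) :
    IsGaussianProcess (fun t : Icc (0 : ℝ) T => B t) P := by
  let _ : OrderBot (Icc (0 : ℝ) T) := { bot := ⟨0, le_rfl, hT⟩, bot_le := fun x => x.2.1 }
  refine HasIndepIncrements.isGaussianProcess (fun t => ⟨?_⟩) h.start h.indep_increments
  have h1 := h.gaussian_increments 0 t le_rfl t.2.1 t.2.2
  have h2 : P.map (fun ω => B t ω - B 0 ω) = P.map (B t) := by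
    refine Measure.map_congr ?_
    filter_upwards [h.start] with ω hω
    rw [hω, sub_zero]
  rw [← h2, h1]
  infer_instance

/-- Increments of a Brownian motion after time `s` are independent of the augmented filtration at
time `s`. -/
theorem IsBrownianMotion.indep_increment [IsProbabilityMeasure P] (h : IsBrownianMotion P T C B)
    (hB : ∀ t, Measurable (B t)) {s u : ℝ} (hs : 0 ≤ s) (hsu : s ≤ u) (hu : u ≤ T) :
    Indep (augmentedFiltration P B hB s)
      (MeasurableSpace.comap (fun ω => B u ω - B s ω) inferInstance) P := by
  refine indep_sup_null ?_
  rw [iSup_comap_Icc_eq]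
  have hT : 0 ≤ T := hs.trans (hsu.trans hu)
  have hG := h.isGaussian hT
  have key : IndepFun (fun ω (r : Icc (0 : ℝ) s) => B r ω)
      (fun ω (_ : Unit) => B u ω - B s ω) P := by
    refine IsGaussianProcess.indepFun_of_covariance_strongDual
      (X := fun r : Icc (0 : ℝ) s => B r) (Y := fun _ : Unit => fun ω => B u ω - B s ω)
      ?_ (fun r => (hB r).aemeasurable) (fun _ => ((hB u).sub (hB s)).aemeasurable) ?_
    · apply IsGaussianProcess.of_isGaussianProcess hG
      rintro (r | _)
      · exact ⟨{⟨r, r.2.1, r.2.2.trans (hsu.trans hu)⟩},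
          { toFun x := x ⟨⟨r, r.2.1, r.2.2.trans (hsu.trans hu)⟩, by simp⟩
            map_add' x y := by simp
            map_smul' c x := by simp }, by simp⟩
      · exact ⟨{⟨s, hs, hsu.trans hu⟩, ⟨u, hs.trans hsu, hu⟩},
          { toFun x := x ⟨⟨u, hs.trans hsu, hu⟩, by simp⟩ - x ⟨⟨s, hs, hsu.trans hu⟩, by simp⟩
            map_add' x y := by simp; abel
            map_smul' c x := by simp [smul_sub] }, by simp⟩
    · intro r _ L₁ L₂
      let τ : ℕ → Icc (0 : ℝ) T
        | 0 => ⟨0, le_rfl, hT⟩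
        | 1 => ⟨r, r.2.1, r.2.2.trans (hsu.trans hu)⟩
        | 2 => ⟨s, hs, hsu.trans hu⟩
        | _ => ⟨u, hs.trans hsu, hu⟩
      have hτ : Monotone τ := by
        refine monotone_nat_of_le_succ fun i => ?_
        match i with
        | 0 => exact r.2.1
        | 1 => exact r.2.2
        | 2 => exact hsu
        | (k + 3) => exact le_rfl
      have hi := (h.indep_increments.nat hτ).indepFun (show (0 : ℕ) ≠ 2 by norm_num)
      have hi' : IndepFun (B r) (fun ω => B u ω - B s ω) P := by
        refine hi.congr ?_ .rfl
        filter_upwards [h.start] with ω hω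
        change B r ω - B 0 ω = B r ω
        rw [hω, sub_zero]
      have m1 : HasGaussianLaw (B r) P :=
        hG.hasGaussianLaw_eval (⟨r, r.2.1, r.2.2.trans (hsu.trans hu)⟩ : Icc (0 : ℝ) T)
      have m2 : HasGaussianLaw (fun ω => B u ω - B s ω) P := by
        constructor
        rw [h.gaussian_increments s u hs hsu hu]
        infer_instance
      refine IndepFun.covariance_eq_zero (hi'.comp L₁.measurable L₂.measurable) ?_ ?_
      · exact (m1.map L₁).memLp_two
      · exact (m2.map L₂).memLp_two
  have key2 := key.comp measurable_id (measurable_pi_apply ())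
  exact key2

end BrownianFiltration

/-! ### Martingale property of Itô integrals -/

section Martingale

variable {Ω : Type*} [mΩ : MeasurableSpace Ω] {n : ℕ}
  {P : Measure Ω} {T : ℝ} {C : Matrix (Fin n) (Fin n) ℝ} {B : ℝ → Ω → E n}

theorem measurable_augmentedFiltration (hB : ∀ t, Measurable (B t)) {s t : ℝ} (hs : 0 ≤ s)
    (hst : s ≤ t) : Measurable[augmentedFiltration P B hB t] (B s) := by
  have h : MeasurableSpace.comap (B s) inferInstance ≤ augmentedFiltration P B hB t :=
    le_sup_of_le_left (le_iSup₂_of_le s ⟨hs, hst⟩ le_rfl)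
  exact (comap_measurable (B s)).mono h le_rfl

theorem IsBrownianMotion.hasGaussianLaw_increment (h : IsBrownianMotion P T C B) {s u : ℝ}
    (hs : 0 ≤ s) (hsu : s ≤ u) (hu : u ≤ T) : HasGaussianLaw (fun ω => B u ω - B s ω) P := by
  constructor
  rw [h.gaussian_increments s u hs hsu hu]
  infer_instance

theorem IsBrownianMotion.integrable_inner_increment (h : IsBrownianMotion P T C B) {s u : ℝ}
    (hs : 0 ≤ s) (hsu : s ≤ u) (hu : u ≤ T) {ξ : Ω → E n} (hξ : StronglyMeasurable ξ)
    (hK : ∃ K : ℝ, ∀ ω, ‖ξ ω‖ ≤ K) : Integrable (fun ω => ⟪ξ ω, B u ω - B s ω⟫) P := by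
  obtain ⟨K, hK⟩ := hK
  have hi := (h.hasGaussianLaw_increment hs hsu hu).integrable
  refine (hi.norm.const_mul K).mono' (hξ.aestronglyMeasurable.inner hi.aestronglyMeasurable)
    (ae_of_all _ fun ω => ?_)
  exact (norm_inner_le_norm _ _).trans (mul_le_mul_of_nonneg_right (hK ω) (norm_nonneg _))

theorem IsBrownianMotion.condExp_inner_increment [IsProbabilityMeasure P]
    (h : IsBrownianMotion P T C B) (hB : ∀ t, Measurable (B t)) {s u : ℝ} (hs : 0 ≤ s)
    (hsu : s ≤ u) (hu : u ≤ T) {ξ : Ω → E n}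
    (hξ : StronglyMeasurable[augmentedFiltration P B hB s] ξ) (hK : ∃ K : ℝ, ∀ ω, ‖ξ ω‖ ≤ K) :
    P[fun ω => ⟪ξ ω, B u ω - B s ω⟫ | augmentedFiltration P B hB s] =ᵐ[P] 0 := by
  set F := augmentedFiltration P B hB
  have hcoord : ∀ i : Fin n, P[fun ω => ξ ω i * (B u ω - B s ω) i | F s] =ᵐ[P] 0 := by
    intro i
    obtain ⟨K, hK⟩ := hK
    have hG := h.hasGaussianLaw_increment hs hsu hu
    have hD : Integrable (fun ω => (B u ω - B s ω) i) P :=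
      (hG.map (EuclideanSpace.proj (𝕜 := ℝ) i)).integrable
    have hξi : StronglyMeasurable[F s] (fun ω => ξ ω i) :=
      (EuclideanSpace.proj (𝕜 := ℝ) i).continuous.comp_stronglyMeasurable hξ
    have hprod : Integrable (fun ω => ξ ω i * (B u ω - B s ω) i) P := by
      refine hD.bdd_mul (c := K) (hξi.mono (F.le s)).aestronglyMeasurable (ae_of_all _ fun ω => ?_)
      exact (PiLp.norm_apply_le _ _).trans (hK ω)
    have h1 := condExp_mul_of_stronglyMeasurable_left (m := F s) (μ := P) hξi hprod hD
    have hmean : ∫ ω, (B u ω - B s ω) i ∂P = 0 := by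
      have hm : ∫ ω, B u ω - B s ω ∂P = 0 := by
        have := integral_map (μ := P) (φ := fun ω => B u ω - B s ω) (f := fun x => x)
          ((hB u).sub (hB s)).aemeasurable aestronglyMeasurable_id
        rw [← this, h.gaussian_increments s u hs hsu hu]
        exact integral_id_multivariateGaussian
      have := (EuclideanSpace.proj (𝕜 := ℝ) i : E n →L[ℝ] ℝ).integral_comp_comm hG.integrable
      simpa [hm] using this
    have h2 := condExp_indep_eq (((hB u).sub (hB s)).comap_le) (F.le s) (μ := P)
      (f := fun ω => (B u ω - B s ω) i)
      (((EuclideanSpace.proj (𝕜 := ℝ) i).continuous.measurable.comp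
        (comap_measurable (fun ω => B u ω - B s ω))).stronglyMeasurable)
      (h.indep_increment hB hs hsu hu).symm
    filter_upwards [h1, h2] with ω h1 h2
    rw [show (fun ω => ξ ω i * (B u ω - B s ω) i) =
      (fun ω => ξ ω i) * (fun ω => (B u ω - B s ω) i) from rfl, h1]
    simp only [Pi.mul_apply, Pi.zero_apply]
    rw [h2, hmean, mul_zero]
  have hint : ∀ i ∈ Finset.univ, Integrable (fun ω => ξ ω i * (B u ω - B s ω) i) P := by
    intro i _
    obtain ⟨K, hK⟩ := hK
    have hD : Integrable (fun ω => (B u ω - B s ω) i) P :=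
      ((h.hasGaussianLaw_increment hs hsu hu).map (EuclideanSpace.proj (𝕜 := ℝ) i)).integrable
    refine hD.bdd_mul (c := K) ?_ (ae_of_all _ fun ω => ?_)
    · exact ((EuclideanSpace.proj (𝕜 := ℝ) i).continuous.comp_stronglyMeasurable
        (hξ.mono (F.le s))).aestronglyMeasurable
    · exact (PiLp.norm_apply_le _ _).trans (hK ω)
  have hsum : (fun ω => ⟪ξ ω, B u ω - B s ω⟫) =
      ∑ i, fun ω => ξ ω i * (B u ω - B s ω) i := by
    funext ω
    rw [Finset.sum_apply, PiLp.inner_apply]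
    exact Finset.sum_congr rfl fun i _ => by simp [mul_comm]
  rw [hsum]
  refine (condExp_finsetSum hint (F s)).trans ?_
  filter_upwards [ae_all_iff.2 hcoord] with ω hω
  rw [Finset.sum_apply]
  exact Finset.sum_eq_zero fun i _ => hω i

/-- The elementary integral of a simple integrand is a martingale. -/
theorem SimpleIntegrand.integral_condExp [IsProbabilityMeasure P]
    (h : IsBrownianMotion P T C B) (hB : ∀ t, Measurable (B t)) {r : ℝ} (hr : r ∈ Icc 0 T)
    (H : SimpleIntegrand (augmentedFiltration P B hB) n) :
    H.integral B r =ᵐ[P] P[H.integral B T | augmentedFiltration P B hB r] := by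
  revert H
  set F := augmentedFiltration P B hB
  intro H
  have hτ : ∀ i, 0 ≤ H.τ i := fun i => H.nonneg.trans (H.mono (Nat.zero_le i))
  have hterm : ∀ t ∈ Icc (0 : ℝ) T, ∀ i, Integrable (fun ω => ⟪H.ξ i ω,
      B (min (H.τ (i + 1)) t) ω - B (min (H.τ i) t) ω⟫) P := fun t ht i =>
    h.integrable_inner_increment (le_min (hτ i) ht.1)
      (min_le_min_right _ (H.mono (Nat.le_succ i))) ((min_le_right _ _).trans ht.2)
      ((H.meas i).mono (F.le _)) (H.bdd i)
  have hint : ∀ t ∈ Icc (0 : ℝ) T, Integrable (H.integral B t) P := fun t ht =>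
    integrable_finsetSum _ fun i _ => hterm t ht i
  have hTT : T ∈ Icc (0 : ℝ) T := ⟨hr.1.trans hr.2, le_rfl⟩
  have hmeas : StronglyMeasurable[F r] (H.integral B r) := by
    refine Finset.stronglyMeasurable_fun_sum _ fun i _ => ?_
    rcases le_total (H.τ i) r with hi | hi
    · refine ((H.meas i).mono (F.mono hi)).inner ?_
      exact ((measurable_augmentedFiltration hB (le_min (hτ _) hr.1)
        (min_le_right _ _)).stronglyMeasurable).sub
        ((measurable_augmentedFiltration hB (le_min (hτ _) hr.1)
        (min_le_right _ _)).stronglyMeasurable)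
    · rw [min_eq_right hi, min_eq_right (hi.trans (H.mono (Nat.le_succ i)))]
      simp only [sub_self, inner_zero_right]
      exact stronglyMeasurable_const
  have hzero : ∀ i, P[fun ω => ⟪H.ξ i ω, B (min (H.τ (i + 1)) T) ω - B (min (H.τ i) T) ω⟫ -
      ⟪H.ξ i ω, B (min (H.τ (i + 1)) r) ω - B (min (H.τ i) r) ω⟫ | F r] =ᵐ[P] 0 := by
    intro i
    -- only the part of the `i`-th time step after `r` contributes
    have hf : ∀ x ω, B (min x T) ω - B (min x r) ω = B (max r (min x T)) ω - B r ω := by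
      intro x ω
      rcases le_total x r with hx | hx
      · rw [min_eq_left hx, min_eq_left (hx.trans hr.2), max_eq_left hx, sub_self, sub_self]
      · rw [min_eq_right hx, max_eq_right (le_min hx hr.2)]
    have heq : (fun ω => ⟪H.ξ i ω, B (min (H.τ (i + 1)) T) ω - B (min (H.τ i) T) ω⟫ -
        ⟪H.ξ i ω, B (min (H.τ (i + 1)) r) ω - B (min (H.τ i) r) ω⟫) = fun ω =>
        ⟪H.ξ i ω, B (max r (min (H.τ (i + 1)) T)) ω - B (max r (min (H.τ i) T)) ω⟫ := by
      funext ω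
      rw [← inner_sub_right]
      congr 1
      have h1 := hf (H.τ (i + 1)) ω
      have h2 := hf (H.τ i) ω
      rw [← sub_sub_sub_cancel_right (B (max r (min (H.τ (i + 1)) T)) ω) _ (B r ω), ← h1, ← h2]
      abel
    rw [heq]
    rcases le_total (H.τ i) T with hi | hi
    · have ha : max r (min (H.τ i) T) = max r (H.τ i) := by rw [min_eq_left hi]
      have hab : max r (min (H.τ i) T) ≤ max r (min (H.τ (i + 1)) T) :=
        max_le_max_left _ (min_le_min_right _ (H.mono (Nat.le_succ i)))
      have hξ : StronglyMeasurable[F (max r (min (H.τ i) T))] (H.ξ i) :=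
        (H.meas i).mono (F.mono (by rw [ha]; exact le_max_right _ _))
      have h0 := h.condExp_inner_increment hB (hr.1.trans (le_max_left _ _)) hab
        (max_le hr.2 (min_le_right _ _)) hξ (H.bdd i)
      refine (condExp_condExp_of_le (F.mono (le_max_left r (min (H.τ i) T))) (F.le _)).symm.trans ?_
      refine (condExp_congr_ae h0).trans ?_
      rw [condExp_zero]
    · rw [min_eq_right hi, min_eq_right (hi.trans (H.mono (Nat.le_succ i)))]
      simp only [sub_self, inner_zero_right]
      rw [show (fun _ : Ω => (0 : ℝ)) = 0 from rfl, condExp_zero]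
  have hdiff : P[H.integral B T - H.integral B r | F r] =ᵐ[P] 0 := by
    have hsum : H.integral B T - H.integral B r = ∑ i ∈ Finset.range H.N, fun ω =>
        ⟪H.ξ i ω, B (min (H.τ (i + 1)) T) ω - B (min (H.τ i) T) ω⟫ -
        ⟪H.ξ i ω, B (min (H.τ (i + 1)) r) ω - B (min (H.τ i) r) ω⟫ := by
      funext ω
      simp [SimpleIntegrand.integral, Finset.sum_sub_distrib]
    rw [hsum]
    refine (condExp_finsetSum (fun i _ => (hterm T hTT i).sub (hterm r hr i)) (F r)).trans ?_
    filter_upwards [ae_all_iff.2 hzero] with ω hω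
    simp only [Finset.sum_apply, Pi.zero_apply]
    exact Finset.sum_eq_zero fun i _ => hω i
  have hsub := condExp_sub (hint T hTT) (hint r hr) (F r)
  rw [condExp_of_stronglyMeasurable (F.le r) hmeas (hint r hr)] at hsub
  filter_upwards [hdiff, hsub] with ω h1 h2
  rw [h2] at h1
  exact sub_eq_zero.1 h1 |>.symm

/-- An Itô integral is a martingale: conditional expectations are contractions of `L²`, so the
property passes from the elementary integrals to their limits. -/
theorem IsItoIntegral.condExp [IsProbabilityMeasure P] (h : IsBrownianMotion P T C B)
    (hB : ∀ t, Measurable (B t)) {R : ℝ → Ω → E n} {M : ℝ → Ω → ℝ}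
    (hM : IsItoIntegral P (augmentedFiltration P B hB) T B R M) {r : ℝ} (hr : r ∈ Icc 0 T) :
    M r =ᵐ[P] P[M T | augmentedFiltration P B hB r] := by
  set F := augmentedFiltration P B hB
  obtain ⟨H, -, hH⟩ := hM.approx
  have hTT : T ∈ Icc (0 : ℝ) T := ⟨hr.1.trans hr.2, le_rfl⟩
  have h1 := hH r hr
  have h2 := hH T hTT
  have hτ : ∀ k i, 0 ≤ (H k).τ i := fun k i => (H k).nonneg.trans ((H k).mono (Nat.zero_le i))
  have hint : ∀ k, ∀ t ∈ Icc (0 : ℝ) T, Integrable ((H k).integral B t) P := fun k t ht =>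
    integrable_finsetSum _ fun i _ => h.integrable_inner_increment (le_min (hτ k i) ht.1)
      (min_le_min_right _ ((H k).mono (Nat.le_succ i))) ((min_le_right _ _).trans ht.2)
      (((H k).meas i).mono (F.le _)) ((H k).bdd i)
  have hMi : ∀ t ∈ Icc (0 : ℝ) T, Integrable (M t) P := fun t ht =>
    (hM.memLp_integral t ht).integrable one_le_two
  have hbound : ∀ k, eLpNorm (M r - P[M T | F r]) 2 P ≤
      eLpNorm (fun ω => (H k).integral B r ω - M r ω) 2 P +
      eLpNorm (fun ω => (H k).integral B T ω - M T ω) 2 P := by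
    intro k
    have e1 : M r - P[M T | F r] =ᵐ[P]
        P[(H k).integral B T - M T | F r] - ((H k).integral B r - M r) := by
      filter_upwards [(H k).integral_condExp h hB hr,
        condExp_sub (hint k T hTT) (hMi T hTT) (F r)] with ω h3 h4
      simp only [Pi.sub_apply] at *
      rw [h4, h3]; ring
    rw [eLpNorm_congr_ae e1]
    refine (eLpNorm_sub_le integrable_condExp.aestronglyMeasurable
      ((hint k r hr).sub (hMi r hr)).aestronglyMeasurable one_le_two).trans ?_
    rw [add_comm]
    exact add_le_add le_rfl (eLpNorm_condExp_le_eLpNorm _ one_le_two)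
  have hlim := h1.add h2
  rw [add_zero] at hlim
  have h0 : eLpNorm (M r - P[M T | F r]) 2 P = 0 :=
    le_antisymm (ge_of_tendsto' hlim hbound) zero_le
  rw [eLpNorm_eq_zero_iff ((hMi r hr).sub integrable_condExp).aestronglyMeasurable
    two_ne_zero] at h0
  filter_upwards [h0] with ω hω
  simpa [sub_eq_zero] using hω

end Martingale

/-! ### Scalar linear backward equations -/

section LinearBSDE

variable {Ω : Type*} [mΩ : MeasurableSpace Ω] {n : ℕ}
  {P : Measure Ω} {T : ℝ} {C : Matrix (Fin n) (Fin n) ℝ} {B : ℝ → Ω → E n}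

/-- Composing with the projection on `[0, T]` removes the values at times outside `[0, T]`, about
which progressive measurability says nothing. -/
theorem ProgressiveOn.measurable_projIcc {ℱ : Filtration ℝ mΩ} {u : ℝ → Ω → ℝ} (hT : 0 ≤ T)
    (hu : ProgressiveOn ℱ T u) :
    Measurable (fun p : ℝ × Ω => u (projIcc 0 T hT p.1) p.2) := by
  have h := (hu T ⟨hT, le_rfl⟩).measurable.mono
    (sup_le_sup_left (MeasurableSpace.comap_mono (ℱ.le T)) _) le_rfl
  have h2 : Measurable (fun p : ℝ × Ω => (projIcc 0 T hT p.1, p.2)) :=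
    ((continuous_projIcc (h := hT)).measurable.comp measurable_fst).prodMk measurable_snd
  exact h.comp h2

theorem ProgressiveOn.stronglyMeasurable {ℱ : Filtration ℝ mΩ} {u : ℝ → Ω → ℝ}
    (hu : ProgressiveOn ℱ T u) {t : ℝ} (ht : t ∈ Icc 0 T) : StronglyMeasurable[ℱ t] (u t) := by
  have h := hu t ht
  have h2 : Measurable[ℱ t, Subtype.instMeasurableSpace.prod (ℱ t)]
      (fun ω : Ω => ((⟨t, ht.1, le_rfl⟩ : Icc (0 : ℝ) t), ω)) :=
    @Measurable.prodMk _ _ _ _ _ (ℱ t) _ _ (@measurable_const _ _ _ (ℱ t) _)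
      (@measurable_id _ (ℱ t))
  exact h.comp_measurable h2

/-- The solution of the linear backward equation `X_T - X_t = -∫_t^T q X dr + (M_T - M_t)` with a
martingale `M`, in the case of a globally integrable and measurable coefficient. No integrability of
the drift over `Ω` is assumed; it comes out of the variation of constants formula, whose integrand
involves the integrable variables `X_T` and `M_T - M_r` only. -/
theorem exp_mul_ae_eq_condExp_of_integrable [IsProbabilityMeasure P]
    (h : IsBrownianMotion P T C B) (hB : ∀ t, Measurable (B t)) {X : ℝ → Ω → ℝ}
    (hX : ProgressiveOn (augmentedFiltration P B hB) T X) (hXT : Integrable (X T) P)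
    {q : ℝ → ℝ} (hqm : Measurable q) (hq : Integrable q)
    (hqX : ∀ᵐ ω ∂P, IntervalIntegrable (fun r => q r * X r ω) volume 0 T)
    {R : ℝ → Ω → E n} {M : ℝ → Ω → ℝ}
    (hM : IsItoIntegral P (augmentedFiltration P B hB) T B R M)
    (heq : ∀ t ∈ Icc (0 : ℝ) T, ∀ᵐ ω ∂P,
      X T ω - X t ω = -(∫ r in t..T, q r * X r ω) + (M T ω - M t ω))
    {t : ℝ} (ht : t ∈ Icc 0 T) :
    (fun ω => Real.exp (-∫ r in t..T, q r) * X t ω) =ᵐ[P]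
      P[X T | augmentedFiltration P B hB t] := by
  set F := augmentedFiltration P B hB
  have hT : 0 ≤ T := ht.1.trans ht.2
  set X' : ℝ → Ω → ℝ := fun r ω => X (projIcc 0 T hT r) ω with hX'
  have hX'm : Measurable (fun p : ℝ × Ω => X' p.1 p.2) := hX.measurable_projIcc hT
  have hXX' : ∀ r ∈ Icc (0 : ℝ) T, X' r = X r := fun r hr => by
    funext ω; simp only [hX', projIcc_of_mem hT hr]
  have htT : Icc t T ⊆ Icc 0 T := Icc_subset_Icc_left ht.1
  have hint_eq : ∀ r ∈ Icc (0 : ℝ) T, ∀ ω,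
      ∫ v in r..T, q v * X v ω = ∫ v in r..T, q v * X' v ω := fun r hr ω => by
    refine intervalIntegral.integral_congr fun v hv => ?_
    rw [uIcc_of_le hr.2] at hv
    simp only [hXX' v ⟨hr.1.trans hv.1, hv.2⟩]
  -- the drift `U r = ∫_r^T q X`, as a jointly measurable process
  set U : ℝ → Ω → ℝ := fun r ω => ∫ v, (Ioc r T).indicator (fun v => q v * X' v ω) v with hU
  have hUm : Measurable (fun p : ℝ × Ω => U p.1 p.2) := by
    have : Measurable (fun p : (ℝ × Ω) × ℝ =>
        (Ioc p.1.1 T).indicator (fun v => q v * X' v p.1.2) p.2) := by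
      have hs : MeasurableSet {p : (ℝ × Ω) × ℝ | p.2 ∈ Ioc p.1.1 T} :=
        (measurableSet_lt (f := fun p : (ℝ × Ω) × ℝ => p.1.1) (g := fun p => p.2)
          (by fun_prop) (by fun_prop)).inter
        (measurableSet_le (f := fun p : (ℝ × Ω) × ℝ => p.2) (g := fun _ => T)
          (by fun_prop) (by fun_prop))
      exact (((hqm.comp measurable_snd).mul (hX'm.comp
        (measurable_snd.prodMk (measurable_snd.comp measurable_fst)))).indicator hs :)
    exact (this.stronglyMeasurable.integral_prod_right' (ν := volume)).measurable
  have hUint : ∀ r ≤ T, ∀ ω, U r ω = ∫ v in r..T, q v * X' v ω := fun r hr ω => by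
    rw [intervalIntegral.integral_of_le hr, ← integral_indicator measurableSet_Ioc]
  set Q : ℝ → ℝ := fun r => ∫ v in r..T, q v with hQ
  have hQc : Continuous Q := by
    have := intervalIntegral.continuous_primitive (fun a b => hq.intervalIntegrable) T
      (f := q) (μ := volume)
    refine (this.neg).congr fun r => ?_
    exact (intervalIntegral.integral_symm (f := q) (μ := volume) T r).symm
  have hQb : ∀ r, |Q r| ≤ ∫ v, |q v| := fun r =>
    (intervalIntegral.norm_integral_le_integral_norm_uIoc).trans
      (setIntegral_le_integral hq.norm (ae_of_all _ fun _ => norm_nonneg _))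
  -- the martingale increment `D r = M_T - M_r`, as a jointly measurable process
  set D : ℝ → Ω → ℝ := fun r ω => X T ω - X' r ω + U r ω with hD
  have hXTm : Measurable (X T) := by
    have := (hX.stronglyMeasurable ⟨hT, le_rfl⟩).mono (F.le T)
    exact this.measurable
  have hDM : ∀ r ∈ Icc (0 : ℝ) T, D r =ᵐ[P] M T - M r := fun r hr => by
    filter_upwards [heq r hr] with ω hω
    rw [hint_eq r hr, ← hUint r hr.2] at hω
    simp only [hD, hXX' r hr, Pi.sub_apply]
    linarith
  have hMi : ∀ t ∈ Icc (0 : ℝ) T, Integrable (M t) P := fun t ht =>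
    (hM.memLp_integral t ht).integrable one_le_two
  have hMT := hMi T ⟨hT, le_rfl⟩
  have hDi : ∀ r ∈ Icc (0 : ℝ) T, Integrable (D r) P := fun r hr =>
    (hMT.sub (hMi r hr)).congr (hDM r hr).symm
  have hDb : ∀ r ∈ Icc (0 : ℝ) T, ∫ ω, |D r ω| ∂P ≤ 2 * ∫ ω, |M T ω| ∂P := fun r hr => by
    have e1 : ∫ ω, |M r ω| ∂P ≤ ∫ ω, |M T ω| ∂P := by
      have e2 := integral_abs_condExp_le (m := F r) (μ := P) (M T)
      have e3 : (fun ω => |M r ω|) =ᵐ[P] fun ω => |(P[M T | F r]) ω| := by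
        filter_upwards [hM.condExp h hB hr] with ω hω
        rw [hω]
      rw [integral_congr_ae e3]
      exact e2
    have e4 : ∫ ω, |D r ω| ∂P ≤ ∫ ω, (|M T ω| + |M r ω|) ∂P := by
      refine integral_mono_ae (hDi r hr).abs (hMT.abs.add (hMi r hr).abs) ?_
      filter_upwards [hDM r hr] with ω hω
      rw [hω]
      exact abs_sub _ _
    rw [integral_add hMT.abs (hMi r hr).abs] at e4
    linarith
  have hD0 : ∀ r ∈ Icc t T, ∀ A, MeasurableSet[F t] A → ∫ ω in A, D r ω ∂P = 0 := by
    intro r hr A hA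
    have hr' := htT hr
    rw [setIntegral_congr_ae (g := M T - M r) (F.le t A hA)
      ((hDM r hr').mono fun ω hω _ => hω)]
    rw [integral_sub' hMT.integrableOn (hMi r hr').integrableOn,
      setIntegral_congr_ae (F.le t A hA) ((hM.condExp h hB hr').mono fun ω hω _ => hω),
      setIntegral_condExp (F.le r) hMT (F.mono hr.1 A hA), sub_self]
  -- Fubini for the integrand of the variation of constants formula
  set G : ℝ × Ω → ℝ := fun p => q p.1 * (X T p.2 - D p.1 p.2) * Real.exp (-Q p.1) with hG
  have hDm : Measurable (fun p : ℝ × Ω => D p.1 p.2) :=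
    ((hXTm.comp measurable_snd).sub hX'm).add hUm
  have hGm : Measurable G :=
    ((hqm.comp measurable_fst).mul ((hXTm.comp measurable_snd).sub hDm)).mul
      (Real.measurable_exp.comp (hQc.measurable.comp measurable_fst).neg)
  have hGi : Integrable G ((volume.restrict (Ioc t T)).prod P) := by
    rw [integrable_prod_iff hGm.aestronglyMeasurable]
    constructor
    · refine (ae_restrict_iff' measurableSet_Ioc).2 (ae_of_all _ fun r hr => ?_)
      exact ((hXT.sub (hDi r (htT (Ioc_subset_Icc_self hr)))).const_mul (q r)).mul_const
        (Real.exp (-Q r))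
    · set K := Real.exp (∫ v, |q v|) * (∫ ω, |X T ω| ∂P + 2 * ∫ ω, |M T ω| ∂P)
      refine ((hq.abs.mul_const K).restrict (s := Ioc t T)).mono'
        (hGm.norm.stronglyMeasurable.integral_prod_right' (ν := P)).aestronglyMeasurable ?_
      refine (ae_restrict_iff' measurableSet_Ioc).2 (ae_of_all _ fun r hr => ?_)
      have hr' := htT (Ioc_subset_Icc_self hr)
      rw [Real.norm_of_nonneg (integral_nonneg fun _ => norm_nonneg _)]
      have e1 : ∀ ω, ‖G (r, ω)‖ = |q r| * Real.exp (-Q r) * |X T ω - D r ω| := fun ω => by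
        simp only [hG, norm_mul, Real.norm_eq_abs, Real.abs_exp]; ring
      simp only [e1]
      rw [integral_const_mul, mul_assoc]
      refine mul_le_mul_of_nonneg_left ?_ (abs_nonneg _)
      refine mul_le_mul (Real.exp_le_exp.2 ?_) ?_ (integral_nonneg fun _ => abs_nonneg _)
        (Real.exp_pos _).le
      · exact (neg_le_abs _).trans (hQb r)
      · calc ∫ ω, |X T ω - D r ω| ∂P ≤ ∫ ω, (|X T ω| + |D r ω|) ∂P :=
              integral_mono (hXT.sub (hDi r hr')).abs (hXT.abs.add (hDi r hr').abs)
                fun ω => abs_sub _ _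
          _ = ∫ ω, |X T ω| ∂P + ∫ ω, |D r ω| ∂P := integral_add hXT.abs (hDi r hr').abs
          _ ≤ _ := by linarith [hDb r hr']
  have hpath : ∀ᵐ ω ∂P, ∫ r in Ioc t T, G (r, ω) = U t ω * Real.exp (-Q t) := by
    filter_upwards [hqX] with ω hω
    have hω' : IntervalIntegrable (fun r => q r * X' r ω) volume t T := by
      have h1 : IntervalIntegrable (fun r => q r * X r ω) volume t T :=
        hω.mono_set (by rw [uIcc_of_le hT, uIcc_of_le ht.2]; exact htT)
      refine h1.congr ?_
      intro r hr
      rw [uIoc_of_le ht.2] at hr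
      simp only [hXX' r (htT (Ioc_subset_Icc_self hr))]
    have h2 := integral_variation_of_constants hq.intervalIntegrable hω'
    rw [hUint t ht.2, ← h2, intervalIntegral.integral_of_le ht.2]
    refine setIntegral_congr_fun measurableSet_Ioc fun r hr => ?_
    simp only [hG, hD, ← hUint r hr.2]
    ring
  have hUi : Integrable (fun ω => U t ω * Real.exp (-Q t)) P :=
    hGi.integral_prod_right.congr hpath
  have hUi' : Integrable (U t) P := by
    refine (hUi.mul_const (Real.exp (Q t))).congr (ae_of_all _ fun ω => ?_)
    simp only [mul_assoc, ← Real.exp_add, neg_add_cancel, Real.exp_zero, mul_one]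
  have hXt : X t =ᵐ[P] fun ω => X T ω + U t ω - D t ω :=
    ae_of_all _ fun ω => by simp only [hD, hXX' t ht]; ring
  have hXti : Integrable (X t) P := ((hXT.add hUi').sub (hDi t ht)).congr hXt.symm
  refine ae_eq_condExp_of_forall_setIntegral_eq (F.le t) hXT
    (fun A _ _ => (hXti.const_mul _).integrableOn) (fun A hA _ => ?_)
    ((hX.stronglyMeasurable ht).const_mul _).aestronglyMeasurable
  have hA' : MeasurableSet A := F.le t A hA
  have hUA : (∫ ω in A, U t ω ∂P) * Real.exp (-Q t) =
      (1 - Real.exp (-Q t)) * ∫ ω in A, X T ω ∂P := by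
    rw [← integral_mul_const, ← setIntegral_congr_ae hA' (hpath.mono fun ω hω _ => hω)]
    have hGA : Integrable G ((volume.restrict (Ioc t T)).prod (P.restrict A)) := by
      refine hGi.mono_measure ?_
      gcongr
      exact Measure.restrict_le_self
    rw [← integral_integral_swap (f := fun r ω => G (r, ω)) hGA]
    have e1 : ∀ r ∈ Ioc t T, ∫ ω in A, G (r, ω) ∂P =
        (q r * Real.exp (-Q r)) * ∫ ω in A, X T ω ∂P := by
      intro r hr
      have e2 : ∀ ω, G (r, ω) = (q r * Real.exp (-Q r)) * (X T ω - D r ω) := fun ω => by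
        simp only [hG]; ring
      simp only [e2]
      rw [integral_const_mul, integral_sub hXT.integrableOn
        (hDi r (htT (Ioc_subset_Icc_self hr))).integrableOn,
        hD0 r (Ioc_subset_Icc_self hr) A hA, sub_zero]
    rw [setIntegral_congr_fun measurableSet_Ioc e1, integral_mul_const,
      ← intervalIntegral.integral_of_le ht.2, integral_mul_exp_neg_integral hq.intervalIntegrable]
  rw [integral_const_mul, setIntegral_congr_ae hA' (hXt.mono fun ω hω _ => hω),
    integral_sub (f := fun ω => X T ω + U t ω) (hXT.add hUi').integrableOn
      (hDi t ht).integrableOn, integral_add hXT.integrableOn hUi'.integrableOn,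
    hD0 t ⟨le_rfl, ht.2⟩ A hA]
  change Real.exp (-Q t) * _ = _
  linear_combination hUA

/-- The linear backward equation `X_T - X_t = -∫_t^T q X dr + (M_T - M_t)` has the solution
`exp (-∫_t^T q) X_t = 𝔼[X_T | ℱ_t]`. -/
theorem exp_mul_ae_eq_condExp [IsProbabilityMeasure P]
    (h : IsBrownianMotion P T C B) (hB : ∀ t, Measurable (B t)) {X : ℝ → Ω → ℝ}
    (hX : ProgressiveOn (augmentedFiltration P B hB) T X) (hXT : Integrable (X T) P)
    {q : ℝ → ℝ} (hq : IntervalIntegrable q volume 0 T)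
    (hqX : ∀ᵐ ω ∂P, IntervalIntegrable (fun r => q r * X r ω) volume 0 T)
    {R : ℝ → Ω → E n} {M : ℝ → Ω → ℝ}
    (hM : IsItoIntegral P (augmentedFiltration P B hB) T B R M)
    (heq : ∀ t ∈ Icc (0 : ℝ) T, ∀ᵐ ω ∂P,
      X T ω - X t ω = -(∫ r in t..T, q r * X r ω) + (M T ω - M t ω))
    {t : ℝ} (ht : t ∈ Icc 0 T) :
    (fun ω => Real.exp (-∫ r in t..T, q r) * X t ω) =ᵐ[P]
      P[X T | augmentedFiltration P B hB t] := by
  have hT : 0 ≤ T := ht.1.trans ht.2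
  have hq1 : IntegrableOn q (Ioc 0 T) := (intervalIntegrable_iff_integrableOn_Ioc_of_le hT).1 hq
  -- replace `q` by a measurable version which vanishes outside `(0, T]`
  set q₁ := hq1.aestronglyMeasurable.mk q with hq₁
  set q₂ := (Ioc 0 T).indicator q₁ with hq₂
  have hm : Measurable q₂ :=
    hq1.aestronglyMeasurable.stronglyMeasurable_mk.measurable.indicator measurableSet_Ioc
  have hae : ∀ᵐ r, r ∈ Ioc 0 T → q r = q₂ r := by
    have := hq1.aestronglyMeasurable.ae_eq_mk
    rw [EventuallyEq, ae_restrict_iff' measurableSet_Ioc] at this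
    filter_upwards [this] with r hr hr'
    rw [hr hr', hq₂, indicator_of_mem hr']
  have hi : Integrable q₂ := by
    rw [hq₂, integrable_indicator_iff measurableSet_Ioc]
    exact hq1.congr hq1.aestronglyMeasurable.ae_eq_mk
  have hcongr : ∀ f : ℝ → ℝ, ∀ s ∈ Icc 0 T, ∫ r in s..T, q r * f r = ∫ r in s..T, q₂ r * f r := by
    intro f s hs
    refine intervalIntegral.integral_congr_ae ?_
    filter_upwards [hae] with r hr hr'
    rw [uIoc_of_le hs.2] at hr'
    rw [hr ⟨hs.1.trans_lt hr'.1, hr'.2⟩]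
  have h1 := hcongr (fun _ => 1) t ht
  simp only [mul_one] at h1
  rw [h1]
  refine exp_mul_ae_eq_condExp_of_integrable h hB hX hXT hm hi ?_ hM (fun s hs => ?_) ht
  · filter_upwards [hqX] with ω hω
    refine hω.congr_ae ?_
    rw [uIoc_of_le hT, EventuallyEq, ae_restrict_iff' measurableSet_Ioc]
    filter_upwards [hae] with r hr hr'
    rw [hr hr']
  · filter_upwards [heq s hs] with ω hω
    rw [hω, hcongr _ s hs]

end LinearBSDE

/-! ### Markov property of Brownian motion -/

section Markov

variable {Ω : Type*} [mΩ : MeasurableSpace Ω] {n : ℕ}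
  {P : Measure Ω} {T : ℝ} {C : Matrix (Fin n) (Fin n) ℝ} {B : ℝ → Ω → E n}

/-- The Markov property of Brownian motion between time `t` and the terminal time. -/
theorem IsBrownianMotion.condExp_terminal [IsProbabilityMeasure P] (h : IsBrownianMotion P T C B)
    (hB : ∀ t, Measurable (B t)) {t : ℝ} (ht : t ∈ Icc 0 T) {g : E n → ℝ} (hg : Measurable g)
    {K : ℝ} (hK : ∀ y, |g y| ≤ K) :
    P[fun ω => g (B T ω) | augmentedFiltration P B hB t] =ᵐ[P]
      fun ω => ∫ x, g (B t ω + x) ∂multivariateGaussian 0 ((T - t) • C) := by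
  set F := augmentedFiltration P B hB
  set N := multivariateGaussian 0 ((T - t) • C)
  set D : Ω → E n := fun ω => B T ω - B t ω
  have hDm : Measurable D := (hB T).sub (hB t)
  have hN : P.map D = N := h.gaussian_increments t T ht.1 ht.2 le_rfl
  have hBt : Measurable[F t] (B t) := measurable_augmentedFiltration hB ht.1 le_rfl
  have hgi : Integrable (fun ω => g (B T ω)) P :=
    Integrable.of_bound (hg.comp (hB T)).aestronglyMeasurable K (ae_of_all _ fun ω => hK _)
  have hGm : StronglyMeasurable (fun y : E n => ∫ x, g (y + x) ∂N) :=
    (hg.comp (measurable_fst.add measurable_snd)).stronglyMeasurable.integral_prod_right'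
      (f := fun p : E n × E n => g (p.1 + p.2))
  have hGb : ∀ y : E n, |∫ x, g (y + x) ∂N| ≤ K := fun y => by
    have := norm_integral_le_of_norm_le_const (μ := N) (f := fun x => g (y + x)) (C := K)
      (ae_of_all _ fun x => hK _)
    simpa using this
  have hGi : Integrable (fun ω => ∫ x, g (B t ω + x) ∂N) P :=
    Integrable.of_bound (hGm.comp_measurable (hB t)).aestronglyMeasurable K
      (ae_of_all _ fun ω => hGb _)
  refine (ae_eq_condExp_of_forall_setIntegral_eq (F.le t) hgi (fun A _ _ => hGi.integrableOn)
    (fun A hA _ => ?_) (hGm.comp_measurable hBt).aestronglyMeasurable).symm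
  have hA' : MeasurableSet A := F.le t A hA
  -- the increment `D` is independent of the pair of `A` and `B t`, both known at time `t`
  set f : Ω → ℝ × E n := fun ω => (A.indicator (fun _ => (1 : ℝ)) ω, B t ω)
  have hind1 : StronglyMeasurable[F t] (A.indicator (fun _ => (1 : ℝ))) :=
    stronglyMeasurable_const.indicator hA
  have hfm : Measurable[F t] f := (hind1.prodMk hBt.stronglyMeasurable).measurable
  have hfm' : Measurable f := hfm.mono (F.le t) le_rfl
  have hind : IndepFun f D P :=
    indep_of_indep_of_le_left (h.indep_increment hB ht.1 ht.2 le_rfl) hfm.comap_le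
  have hlaw := (indepFun_iff_map_prod_eq_prod_map_map hfm'.aemeasurable hDm.aemeasurable).1 hind
  rw [hN] at hlaw
  set H : (ℝ × E n) × E n → ℝ := fun p => p.1.1 * g (p.1.2 + p.2)
  have hHm : Measurable H := (measurable_fst.comp measurable_fst).mul
    (hg.comp ((measurable_snd.comp measurable_fst).add measurable_snd))
  have hpair : Measurable fun ω => (f ω, D ω) := hfm'.prodMk hDm
  have hHω : ∀ ω, H (f ω, D ω) = A.indicator (fun ω => g (B T ω)) ω := fun ω => by
    by_cases hω : ω ∈ A <;> simp [H, f, D, hω]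
  have hHi : Integrable H ((P.map f).prod N) := by
    rw [← hlaw, integrable_map_measure hHm.aestronglyMeasurable hpair.aemeasurable]
    exact (hgi.indicator hA').congr (ae_of_all _ fun ω => (hHω ω).symm)
  have e1 : ∫ ω in A, g (B T ω) ∂P = ∫ p, H p ∂((P.map f).prod N) := by
    rw [← hlaw, integral_map hpair.aemeasurable hHm.aestronglyMeasurable,
      ← integral_indicator hA']
    exact integral_congr_ae (ae_of_all _ fun ω => (hHω ω).symm)
  rw [e1, integral_prod _ hHi, integral_map hfm'.aemeasurable
    hHm.stronglyMeasurable.integral_prod_right'.aestronglyMeasurable, ← integral_indicator hA']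
  refine integral_congr_ae (ae_of_all _ fun ω => ?_)
  by_cases hω : ω ∈ A <;> simp [H, f, hω]

end Markov

/-! ### Characteristic functions on `ℝⁿ × ℝⁿ` -/

section CharacteristicFunctions

variable {n : ℕ}

theorem charFunDual_multivariateGaussian {S : Matrix (Fin n) (Fin n) ℝ} (hS : S.PosSemidef)
    (L : StrongDual ℝ (E n)) :
    charFunDual (multivariateGaussian 0 S) L = Real.exp (-((1 / 2) * ∑ i, ∑ j,
      S i j * (L (EuclideanSpace.single i 1) * L (EuclideanSpace.single j 1)))) := by
  rw [← charFun_toDual_symm_eq_charFunDual, charFun_multivariateGaussian hS]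
  set x := (InnerProductSpace.toDual ℝ (E n)).symm L with hx
  have hL : ∀ i, L (EuclideanSpace.single i 1) = x i := fun i => by
    have : L (EuclideanSpace.single i 1) = ⟪x, EuclideanSpace.single i (1 : ℝ)⟫ := by
      rw [hx, InnerProductSpace.toDual_symm_apply]
    rw [this, EuclideanSpace.inner_single_right]
    simp
  simp only [hL, inner_zero_right]
  have h2 : x.ofLp ⬝ᵥ S.mulVec x.ofLp = ∑ i, ∑ j, S i j * (x i * x j) := by
    simp only [dotProduct, Matrix.mulVec, Finset.mul_sum]
    exact Finset.sum_congr rfl fun i _ => Finset.sum_congr rfl fun j _ => by ring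
  rw [h2, Complex.ofReal_exp]
  congr 1
  push_cast
  ring

theorem integrable_comp_dual (μ : Measure (E n × E n)) [IsFiniteMeasure μ] {f : ℝ → ℝ}
    (hf : Continuous f) (hb : ∀ x, |f x| ≤ 1) (L : StrongDual ℝ (E n × E n)) :
    Integrable (fun x => f (L x)) μ :=
  Integrable.of_bound (hf.comp L.continuous).aestronglyMeasurable 1 (ae_of_all _ fun _ => hb _)

theorem charFunDual_eq_cos_sin (μ : Measure (E n × E n)) [IsFiniteMeasure μ]
    (L : StrongDual ℝ (E n × E n)) :
    charFunDual μ L =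
      (∫ x, Real.cos (L x) ∂μ : ℝ) + (∫ x, Real.sin (L x) ∂μ : ℝ) * Complex.I := by
  rw [charFunDual_apply, ← integral_complex_ofReal, ← integral_complex_ofReal,
    ← integral_mul_const, ← integral_add]
  · refine integral_congr_ae (ae_of_all _ fun x => ?_)
    simp only [Complex.exp_mul_I, Complex.ofReal_cos, Complex.ofReal_sin]
  · exact (integrable_comp_dual μ Real.continuous_cos Real.abs_cos_le_one L).ofReal
  · exact ((integrable_comp_dual μ Real.continuous_sin Real.abs_sin_le_one L).ofReal).mul_const _

theorem continuous_integral_comp_dual (μ : Measure (E n × E n)) [IsFiniteMeasure μ] {f : ℝ → ℝ}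
    (hf : Continuous f) (hb : ∀ x, |f x| ≤ 1) :
    Continuous fun L : StrongDual ℝ (E n × E n) => ∫ x, f (L x) ∂μ := by
  refine continuous_of_dominated (bound := fun _ => 1) (fun L => ?_)
    (fun L => ae_of_all _ fun x => hb _) (integrable_const _) (ae_of_all _ fun x => ?_)
  · exact (hf.comp L.continuous).aestronglyMeasurable
  · exact hf.comp (ContinuousLinearMap.apply ℝ ℝ x).continuous

/-- The image of a measure on `ℝⁿ` under `z ↦ (z, 0)`. -/
def liftFst (ν : Measure (E n)) : Measure (E n × E n) := ν.map fun z => (z, 0)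

/-- The image of a measure on `ℝⁿ` under `s ↦ (0, s)`. -/
def liftSnd (ν : Measure (E n)) : Measure (E n × E n) := ν.map fun s => (0, s)

instance (ν : Measure (E n)) [IsFiniteMeasure ν] : IsFiniteMeasure (liftFst ν) := by
  unfold liftFst; infer_instance

instance (ν : Measure (E n)) [IsFiniteMeasure ν] : IsFiniteMeasure (liftSnd ν) := by
  unfold liftSnd; infer_instance

theorem charFunDual_liftFst (ν : Measure (E n)) (L : StrongDual ℝ (E n × E n)) :
    charFunDual (liftFst ν) L = charFunDual ν (L.comp (.inl ℝ (E n) (E n))) :=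
  charFunDual_map (ContinuousLinearMap.inl ℝ (E n) (E n)) L

theorem charFunDual_liftSnd (ν : Measure (E n)) (L : StrongDual ℝ (E n × E n)) :
    charFunDual (liftSnd ν) L = charFunDual ν (L.comp (.inr ℝ (E n) (E n))) :=
  charFunDual_map (ContinuousLinearMap.inr ℝ (E n) (E n)) L

end CharacteristicFunctions

/-! ### The solution of the backward equation as a deconvolution -/

section Deconvolution

variable {n : ℕ}

theorem intervalIntegrable_sum_fun {f : Fin n → ℝ → ℝ} {a b : ℝ}
    (h : ∀ i, IntervalIntegrable (f i) volume a b) :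
    IntervalIntegrable (fun r => ∑ i, f i r) volume a b := by
  have := IntervalIntegrable.sum Finset.univ fun i _ => h i
  rwa [Finset.sum_fn] at this

theorem continuous_symbol (A C : Matrix (Fin n) (Fin n) ℝ) : Continuous (symbol A C) := by
  unfold symbol
  fun_prop

/-- The covariance matrix `∫_t^T σ_r² dr` of the signal increment. -/
def signalCov (σt : ℝ → Matrix (Fin n) (Fin n) ℝ) (t T : ℝ) : Matrix (Fin n) (Fin n) ℝ :=
  Matrix.of fun i j => ∫ r in t..T, (σt r * σt r) i j

variable {T : ℝ} {σt : ℝ → Matrix (Fin n) (Fin n) ℝ}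

theorem intervalIntegrable_mul_self_apply (hT : 0 ≤ T)
    (hL2 : ∀ i j, MemLp (fun r => σt r i j) 2 (volume.restrict (Icc 0 T))) (i j : Fin n) :
    IntervalIntegrable (fun r => (σt r * σt r) i j) volume 0 T := by
  rw [intervalIntegrable_iff_integrableOn_Icc_of_le hT]
  simp only [Matrix.mul_apply]
  exact integrable_finsetSum _ fun k _ => (hL2 i k).integrable_mul (hL2 k j)

theorem posSemidef_signalCov (hpsd : ∀ r ∈ Icc (0 : ℝ) T, (σt r).PosSemidef)
    (hL2 : ∀ i j, MemLp (fun r => σt r i j) 2 (volume.restrict (Icc 0 T))) {t : ℝ}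
    (ht : t ∈ Icc 0 T) : (signalCov σt t T).PosSemidef := by
  have hT : 0 ≤ T := ht.1.trans ht.2
  have hsub : Icc t T ⊆ Icc 0 T := Icc_subset_Icc_left ht.1
  have hi : ∀ i j, IntervalIntegrable (fun r => (σt r * σt r) i j) volume t T := fun i j =>
    (intervalIntegrable_mul_self_apply hT hL2 i j).mono_set
      (by rwa [uIcc_of_le hT, uIcc_of_le ht.2])
  have hsq : ∀ r ∈ Icc t T, (σt r * σt r).PosSemidef := fun r hr => by
    have h := Matrix.posSemidef_conjTranspose_mul_self (σt r)
    rwa [(hpsd r (hsub hr)).isHermitian.eq] at h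
  refine Matrix.PosSemidef.of_dotProduct_mulVec_nonneg ?_ fun x => ?_
  · ext i j
    rw [Matrix.conjTranspose_apply, star_trivial]
    refine intervalIntegral.integral_congr fun r hr => ?_
    rw [uIcc_of_le ht.2] at hr
    have := congrFun (congrFun (hsq r hr).isHermitian.eq i) j
    simpa using this
  · have h : star x ⬝ᵥ (signalCov σt t T).mulVec x =
        ∫ r in t..T, star x ⬝ᵥ (σt r * σt r).mulVec x := by
      simp only [dotProduct, Matrix.mulVec, Finset.mul_sum]
      rw [intervalIntegral.integral_finsetSum fun i _ => ?_]
      · refine Finset.sum_congr rfl fun i _ => ?_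
        rw [intervalIntegral.integral_finsetSum fun j _ => ?_]
        · refine Finset.sum_congr rfl fun j _ => ?_
          rw [intervalIntegral.integral_const_mul, intervalIntegral.integral_mul_const]
          rfl
        · exact ((hi i j).mul_const _).const_mul _
      · exact intervalIntegrable_sum_fun fun j => ((hi i j).mul_const _).const_mul _
    rw [h]
    exact intervalIntegral.integral_nonneg ht.2 fun r hr => (hsq r hr).dotProduct_mulVec_nonneg x

theorem intervalIntegrable_symbol (hT : 0 ≤ T)
    (hL2 : ∀ i j, MemLp (fun r => σt r i j) 2 (volume.restrict (Icc 0 T)))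
    (A : Matrix (Fin n) (Fin n) ℝ) (L : StrongDual ℝ (E n × E n)) :
    IntervalIntegrable (fun r => symbol A (σt r * σt r) L) volume 0 T := by
  unfold symbol
  refine IntervalIntegrable.const_mul (intervalIntegrable_sum_fun fun i =>
    intervalIntegrable_sum_fun fun j => ?_) _
  exact intervalIntegrable_const.add
    ((intervalIntegrable_mul_self_apply hT hL2 i j).mul_const _)

theorem integral_symbol (hL2 : ∀ i j, MemLp (fun r => σt r i j) 2 (volume.restrict (Icc 0 T)))
    (A : Matrix (Fin n) (Fin n) ℝ) (L : StrongDual ℝ (E n × E n)) {t : ℝ} (ht : t ∈ Icc 0 T) :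
    ∫ r in t..T, symbol A (σt r * σt r) L = symbol ((T - t) • A) (signalCov σt t T) L := by
  have hT : 0 ≤ T := ht.1.trans ht.2
  have hi : ∀ i j, IntervalIntegrable (fun r => (σt r * σt r) i j) volume t T := fun i j =>
    (intervalIntegrable_mul_self_apply hT hL2 i j).mono_set
      (by rw [uIcc_of_le hT, uIcc_of_le ht.2]; exact Icc_subset_Icc_left ht.1)
  unfold symbol
  rw [intervalIntegral.integral_const_mul, intervalIntegral.integral_finsetSum fun i _ => ?_]
  · congr 1
    refine Finset.sum_congr rfl fun i _ => ?_
    rw [intervalIntegral.integral_finsetSum fun j _ => ?_]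
    · refine Finset.sum_congr rfl fun j _ => ?_
      rw [intervalIntegral.integral_add intervalIntegrable_const ((hi i j).mul_const _),
        intervalIntegral.integral_const, intervalIntegral.integral_mul_const]
      simp only [smul_eq_mul, Matrix.smul_apply, signalCov, Matrix.of_apply]
      ring
    · exact intervalIntegrable_const.add ((hi i j).mul_const _)
  · exact intervalIntegrable_sum_fun fun j => intervalIntegrable_const.add ((hi i j).mul_const _)

/-- The Gaussian law whose characteristic function is the exponential factor in the solution of
the linear equation. -/
theorem charFunDual_gaussian_conv {A C : Matrix (Fin n) (Fin n) ℝ} (hA : A.PosSemidef)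
    (hC : C.PosSemidef) (L : StrongDual ℝ (E n × E n)) :
    charFunDual (liftFst (multivariateGaussian 0 A) ∗ liftSnd (multivariateGaussian 0 C)) L =
      Real.exp (-symbol A C L) := by
  rw [charFunDual_conv, charFunDual_liftFst, charFunDual_liftSnd,
    charFunDual_multivariateGaussian hA, charFunDual_multivariateGaussian hC,
    ← Complex.ofReal_mul, ← Real.exp_add]
  congr 2
  simp only [symbol, ContinuousLinearMap.comp_apply, ContinuousLinearMap.inl_apply,
    ContinuousLinearMap.inr_apply, Finset.sum_add_distrib]
  ring

variable {Ω : Type*} [mΩ : MeasurableSpace Ω] {P : Measure Ω} [IsProbabilityMeasure P]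
  {σ : Matrix (Fin n) (Fin n) ℝ} {Y : ℝ → Ω → E n}
  {κ : Kernel (E n) (E n × E n)} [IsMarkovKernel κ]
  {ρ : ℝ → Ω → SignedMeasure (E n × E n)} {R : (E n × E n → ℝ) → ℝ → Ω → E n}

/-- Tested against a real character `f ∘ L`, the backward equation becomes a scalar linear
equation, whose solution is a conditional expectation of the terminal value. -/
theorem IsBSPDESolution.exp_mul_pairing_eq (hY : IsBrownianMotion P T (σ * σ) Y)
    (hYm : ∀ t, Measurable (Y t))
    (hρ : IsBSPDESolution P (augmentedFiltration P Y hYm) T σ σt Y κ ρ R)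
    (hL2 : ∀ i j, MemLp (fun r => σt r i j) 2 (volume.restrict (Icc 0 T)))
    {t : ℝ} (ht : t ∈ Icc 0 T) {f : ℝ → ℝ} (hf : ContDiff ℝ (⊤ : ℕ∞) f)
    (hb : ∀ k x, |iteratedDeriv k f x| ≤ 1) (h2 : ∀ x, iteratedDeriv 2 f x = -f x)
    (L : StrongDual ℝ (E n × E n)) :
    ∀ᵐ ω ∂P, Real.exp (-symbol ((T - t) • (σ * σ)) (signalCov σt t T) L) *
      pairing (ρ t ω) (fun x => f (L x)) =
      ∫ x, f (L x) ∂(κ ∘ₘ (multivariateGaussian 0 ((T - t) • (σ * σ))).map (Y t ω + ·)) := by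
  have hT : 0 ≤ T := ht.1.trans ht.2
  have hφ := isTestFunction_comp_dual hf hb L
  have hb0 : ∀ x, |f x| ≤ 1 := fun x => by simpa using hb 0 x
  set φ : E n × E n → ℝ := fun x => f (L x) with hφdef
  set q : ℝ → ℝ := fun r => symbol (σ * σ) (σt r * σt r) L
  have hdrift : ∀ r ω, pairing (ρ r ω) (generator (σ * σ) (σt r * σt r) φ) =
      -(q r * pairing (ρ r ω) φ) := fun r ω => by
    have : generator (σ * σ) (σt r * σt r) φ = fun x => -q r * φ x :=
      funext fun x => generator_comp_dual hf h2 _ _ L x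
    rw [this, pairing_const_mul]
    ring
  obtain ⟨M, hM, heq⟩ := hρ.equation φ hφ
  set g : E n → ℝ := fun y => ∫ x, φ x ∂κ y
  have hgm : Measurable g := hφ.1.continuous.stronglyMeasurable.integral_kernel.measurable
  have hgb : ∀ y, |g y| ≤ 1 := fun y => by
    have := norm_integral_le_of_norm_le_const (μ := κ y) (f := φ) (C := 1)
      (ae_of_all _ fun x => hb0 _)
    simpa using this
  have hterm : (fun ω => pairing (ρ T ω) φ) =ᵐ[P] fun ω => g (Y T ω) := by
    filter_upwards [hρ.terminal] with ω hω
    rw [hω, pairing_toSignedMeasure]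
  have hgi : Integrable (fun ω => g (Y T ω)) P :=
    Integrable.of_bound (hgm.comp (hYm T)).aestronglyMeasurable 1 (ae_of_all _ fun ω => hgb _)
  have key := exp_mul_ae_eq_condExp hY hYm (X := fun r ω => pairing (ρ r ω) φ)
    (hρ.progressive φ hφ) (hgi.congr hterm.symm) (q := q) (intervalIntegrable_symbol hT hL2 _ L)
    (by
      filter_upwards [hρ.integrable_drift φ hφ] with ω hω
      simp only [hdrift] at hω
      have := hω.neg
      simp only [Pi.neg_def, neg_neg] at this
      exact this) hM
    (fun s hs => by
      filter_upwards [heq s hs] with ω hω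
      simp only [hdrift, intervalIntegral.integral_neg] at hω
      exact hω) ht
  filter_upwards [key, condExp_congr_ae (m := augmentedFiltration P Y hYm t) hterm,
    hY.condExp_terminal hYm ht hgm hgb] with ω h3 h4 h5
  rw [← integral_symbol hL2 _ L ht, h3, h4, h5]
  have hmap : Measurable (Y t ω + · : E n → E n) := measurable_const_add _
  have hint : Integrable φ (κ ∘ₘ (multivariateGaussian 0 ((T - t) • (σ * σ))).map (Y t ω + ·)) :=
    integrable_of_isTestFunction _ hφ
  rw [Measure.comp_eq_comp_const_apply] at hint ⊢
  rw [Kernel.integral_comp hint, Kernel.const_apply,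
    integral_map hmap.aemeasurable hgm.aestronglyMeasurable]

/-- At every time the solution of the backward equation is, almost surely, a deconvolution of a
mixture of the terminal measures by a Gaussian measure. Stated without subtraction, in terms of
the Jordan decomposition. -/
theorem IsBSPDESolution.conv_eq (hσ : (σ * σ).PosSemidef) (hY : IsBrownianMotion P T (σ * σ) Y)
    (hYm : ∀ t, Measurable (Y t))
    (hρ : IsBSPDESolution P (augmentedFiltration P Y hYm) T σ σt Y κ ρ R)
    (hpsd : ∀ r ∈ Icc (0 : ℝ) T, (σt r).PosSemidef)
    (hL2 : ∀ i j, MemLp (fun r => σt r i j) 2 (volume.restrict (Icc 0 T)))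
    {t : ℝ} (ht : t ∈ Icc 0 T) :
    ∀ᵐ ω ∂P,
      κ ∘ₘ (multivariateGaussian 0 ((T - t) • (σ * σ))).map (Y t ω + ·) +
        (ρ t ω).toJordanDecomposition.negPart ∗
          (liftFst (multivariateGaussian 0 ((T - t) • (σ * σ))) ∗
            liftSnd (multivariateGaussian 0 (signalCov σt t T))) =
      (ρ t ω).toJordanDecomposition.posPart ∗
          (liftFst (multivariateGaussian 0 ((T - t) • (σ * σ))) ∗
            liftSnd (multivariateGaussian 0 (signalCov σt t T))) := by
  have hA : ((T - t) • (σ * σ)).PosSemidef := hσ.smul (sub_nonneg.2 ht.2)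
  have hC := posSemidef_signalCov hpsd hL2 ht
  have hcos2 : ∀ x, iteratedDeriv 2 Real.cos x = -Real.cos x := fun x => by simp
  have hsin2 : ∀ x, iteratedDeriv 2 Real.sin x = -Real.sin x := fun x => by simp
  have : SecondCountableTopology (StrongDual ℝ (E n × E n)) :=
    have := FiniteDimensional.proper ℝ (StrongDual ℝ (E n × E n))
    inferInstance
  have hcos := ae_all_iff.2 fun k : ℕ => hρ.exp_mul_pairing_eq hY hYm hL2 ht Real.contDiff_cos
    Real.abs_iteratedDeriv_cos_le_one hcos2 (TopologicalSpace.denseSeq (StrongDual ℝ (E n × E n)) k)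
  have hsin := ae_all_iff.2 fun k : ℕ => hρ.exp_mul_pairing_eq hY hYm hL2 ht Real.contDiff_sin
    Real.abs_iteratedDeriv_sin_le_one hsin2 (TopologicalSpace.denseSeq (StrongDual ℝ (E n × E n)) k)
  filter_upwards [hcos, hsin] with ω hc hs
  set m := κ ∘ₘ (multivariateGaussian 0 ((T - t) • (σ * σ))).map (Y t ω + ·)
  set ρp := (ρ t ω).toJordanDecomposition.posPart
  set ρn := (ρ t ω).toJordanDecomposition.negPart
  -- both sides are continuous in the frequency, so the identity extends from a dense sequence
  have hext : ∀ f : ℝ → ℝ, ContDiff ℝ (⊤ : ℕ∞) f → (∀ k x, |iteratedDeriv k f x| ≤ 1) →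
      (∀ k, Real.exp (-symbol ((T - t) • (σ * σ)) (signalCov σt t T)
        (TopologicalSpace.denseSeq (StrongDual ℝ (E n × E n)) k)) *
        pairing (ρ t ω) (fun x => f (TopologicalSpace.denseSeq (StrongDual ℝ (E n × E n)) k x)) =
        ∫ x, f (TopologicalSpace.denseSeq (StrongDual ℝ (E n × E n)) k x) ∂m) →
      ∀ L : StrongDual ℝ (E n × E n),
        Real.exp (-symbol ((T - t) • (σ * σ)) (signalCov σt t T) L) *
        (∫ x, f (L x) ∂ρp - ∫ x, f (L x) ∂ρn) = ∫ x, f (L x) ∂m := by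
    intro f hf hb h
    have hb0 : ∀ x, |f x| ≤ 1 := fun x => by simpa using hb 0 x
    refine congrFun ((TopologicalSpace.denseRange_denseSeq (StrongDual ℝ (E n × E n))).equalizer
      ((Real.continuous_exp.comp (continuous_symbol _ _).neg).mul
        ((continuous_integral_comp_dual ρp hf.continuous hb0).sub
          (continuous_integral_comp_dual ρn hf.continuous hb0)))
      (continuous_integral_comp_dual m hf.continuous hb0) (funext fun k => ?_))
    have := h k
    rw [pairing_eq_sub _ (isTestFunction_comp_dual hf hb _)] at this
    exact this
  have hc' := hext _ Real.contDiff_cos Real.abs_iteratedDeriv_cos_le_one hc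
  have hs' := hext _ Real.contDiff_sin Real.abs_iteratedDeriv_sin_le_one hs
  refine Measure.ext_of_charFunDual (funext fun L => ?_)
  have hadd : ∀ (μ ν : Measure (E n × E n)) [IsFiniteMeasure μ] [IsFiniteMeasure ν],
      charFunDual (μ + ν) L = charFunDual μ L + charFunDual ν L := fun μ ν _ _ => by
    rw [charFunDual_apply, charFunDual_apply, charFunDual_apply, integral_add_measure]
    all_goals
      refine Integrable.of_bound (by fun_prop) 1 (ae_of_all _ fun x => ?_)
      exact (Complex.norm_exp_ofReal_mul_I _).le
  rw [hadd, charFunDual_conv, charFunDual_conv (μ := ρp), charFunDual_gaussian_conv hA hC,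
    charFunDual_eq_cos_sin m, charFunDual_eq_cos_sin ρn, charFunDual_eq_cos_sin ρp,
    ← hc' L, ← hs' L]
  push_cast
  ring

end Deconvolution

/-! ### Gaussian densities -/

section GaussianDensity

variable {F : Type*} [NormedAddCommGroup F] [InnerProductSpace ℝ F] [FiniteDimensional ℝ F]
  [MeasurableSpace F] [BorelSpace F]

theorem integrable_exp_neg_norm_sq :
    Integrable (fun x : F => Real.exp (-‖x‖ ^ 2 / 2)) := by
  have h := (GaussianFourier.integrable_cexp_neg_mul_sq_norm_add (V := F) (b := 1 / 2)
    (by norm_num) 0 0).re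
  refine h.congr (ae_of_all _ fun x => ?_)
  have : (-(1 / 2) * (‖x‖ : ℂ) ^ 2 + 0 * ((⟪(0 : F), x⟫ : ℝ) : ℂ)) = ((-‖x‖ ^ 2 / 2 : ℝ) : ℂ) := by
    push_cast; ring
  simp only [this, ← Complex.ofReal_exp]
  rfl

/-- Up to normalization, the Gaussian function is its own Fourier transform. -/
theorem integral_exp_neg_norm_sq_mul_exp_inner (t : F) :
    ∫ x : F, (Real.exp (-‖x‖ ^ 2 / 2) : ℂ) * Complex.exp (⟪x, t⟫ * Complex.I) =
      (∫ x : F, Real.exp (-‖x‖ ^ 2 / 2) : ℝ) * Complex.exp (-‖t‖ ^ 2 / 2) := by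
  have h (w : F) := GaussianFourier.integral_cexp_neg_mul_sq_norm_add (V := F) (b := 1 / 2)
    (by norm_num) Complex.I w
  have h0 : ((∫ x : F, Real.exp (-‖x‖ ^ 2 / 2) : ℝ) : ℂ) =
      (Real.pi / (1 / 2 : ℂ)) ^ (Module.finrank ℝ F / 2 : ℂ) := by
    have := h 0
    rw [← integral_complex_ofReal]
    convert this using 1
    · refine integral_congr_ae (ae_of_all _ fun x => ?_)
      simp only [Complex.ofReal_exp]
      congr 1
      push_cast [inner_zero_left]
      ring
    · simp
  rw [h0]
  convert h t using 1
  · refine integral_congr_ae (ae_of_all _ fun x => ?_)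
    simp only [Complex.ofReal_exp]
    rw [← Complex.exp_add]
    congr 1
    rw [real_inner_comm]
    push_cast
    ring
  · congr 2
    rw [Complex.I_sq]
    ring

theorem stdGaussian_eq_withDensity :
    ∃ K : ℝ, 0 < K ∧ stdGaussian F =
      volume.withDensity (fun x => ENNReal.ofReal (K * Real.exp (-‖x‖ ^ 2 / 2))) := by
  have hpos : 0 < ∫ x : F, Real.exp (-‖x‖ ^ 2 / 2) := by
    rw [integral_pos_iff_support_of_nonneg (fun x => (Real.exp_pos _).le)
      integrable_exp_neg_norm_sq]
    have : Function.support (fun x : F => Real.exp (-‖x‖ ^ 2 / 2)) = univ := by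
      ext x; simp
    rw [this]
    exact Measure.measure_univ_pos.2 NeZero.out
  set c := ∫ x : F, Real.exp (-‖x‖ ^ 2 / 2) with hc
  refine ⟨c⁻¹, inv_pos.2 hpos, ?_⟩
  have hint : Integrable (fun x : F => c⁻¹ * Real.exp (-‖x‖ ^ 2 / 2)) :=
    integrable_exp_neg_norm_sq.const_mul _
  have := isFiniteMeasure_withDensity_ofReal hint.2
  refine Measure.ext_of_charFun ?_
  ext t
  rw [charFun_stdGaussian, charFun_apply,
    integral_withDensity_eq_integral_toReal_smul (by fun_prop) (ae_of_all _ fun x => by simp)]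
  have : ∀ x : F, (ENNReal.ofReal (c⁻¹ * Real.exp (-‖x‖ ^ 2 / 2))).toReal •
      Complex.exp (⟪x, t⟫ * Complex.I) = (c⁻¹ : ℂ) *
        ((Real.exp (-‖x‖ ^ 2 / 2) : ℂ) * Complex.exp (⟪x, t⟫ * Complex.I)) := fun x => by
    rw [ENNReal.toReal_ofReal (by positivity), Complex.real_smul]
    push_cast
    ring
  simp only [this]
  rw [integral_const_mul, integral_exp_neg_norm_sq_mul_exp_inner, ← hc, ← mul_assoc,
    inv_mul_cancel₀ (by exact_mod_cast hpos.ne'), one_mul]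

theorem map_stdGaussian_eq_withDensity (A M : F →L[ℝ] F) (hAM : ∀ x, A (M x) = x)
    (hMA : ∀ x, M (A x) = x) :
    ∃ K : ℝ, 0 < K ∧ (stdGaussian F).map A =
      volume.withDensity (fun x => ENNReal.ofReal (K * Real.exp (-‖M x‖ ^ 2 / 2))) := by
  obtain ⟨K, hK, h⟩ := stdGaussian_eq_withDensity (F := F)
  have hdet : LinearMap.det (A : F →ₗ[ℝ] F) ≠ 0 := by
    have h1 : (A : F →ₗ[ℝ] F) ∘ₗ (M : F →ₗ[ℝ] F) = LinearMap.id := by ext x; simp [hAM]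
    have h2 := congrArg LinearMap.det h1
    rw [LinearMap.det_comp, LinearMap.det_id] at h2
    exact left_ne_zero_of_mul_eq_one h2
  have hvol := Measure.map_linearMap_addHaar_eq_smul_addHaar (μ := (volume : Measure F)) hdet
  set d := |(LinearMap.det (A : F →ₗ[ℝ] F))⁻¹| with hd
  have hdpos : 0 < d := abs_pos.2 (inv_ne_zero hdet)
  refine ⟨d * K, by positivity, Measure.ext fun s hs => ?_⟩
  rw [Measure.map_apply A.measurable hs, h, withDensity_apply _ (A.measurable hs),
    withDensity_apply _ hs]
  have h3 : ∀ x, ENNReal.ofReal (d * K * Real.exp (-‖M x‖ ^ 2 / 2)) =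
      ENNReal.ofReal d * ENNReal.ofReal (K * Real.exp (-‖M x‖ ^ 2 / 2)) := fun x => by
    rw [mul_assoc, ENNReal.ofReal_mul hdpos.le]
  have h4 : ∫⁻ x in s, ENNReal.ofReal (K * Real.exp (-‖M x‖ ^ 2 / 2))
      ∂(volume.map (A : F →ₗ[ℝ] F)) =
      ∫⁻ x in A ⁻¹' s, ENNReal.ofReal (K * Real.exp (-‖x‖ ^ 2 / 2)) := by
    have hAm : Measurable (A : F →ₗ[ℝ] F) := A.measurable
    rw [Measure.restrict_map hAm hs, lintegral_map (by fun_prop) hAm]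
    refine lintegral_congr fun x => ?_
    simp [hMA]
  simp only [h3]
  rw [← h4, hvol, Measure.restrict_smul, lintegral_smul_measure,
    lintegral_const_mul _ (by fun_prop), smul_eq_mul]

end GaussianDensity

section Matrix

variable {n : ℕ}

theorem toEuclideanCLM_apply_inv_apply {σ : Matrix (Fin n) (Fin n) ℝ} (hσ : IsUnit σ.det)
    (x : E n) :
    Matrix.toEuclideanCLM (𝕜 := ℝ) σ (Matrix.toEuclideanCLM (𝕜 := ℝ) σ⁻¹ x) = x := by
  have h := DFunLike.congr_fun (map_mul (Matrix.toEuclideanCLM (n := Fin n) (𝕜 := ℝ)) σ σ⁻¹) x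
  rw [Matrix.mul_nonsing_inv _ hσ, map_one] at h
  exact h.symm

theorem toEuclideanCLM_inv_apply_apply {σ : Matrix (Fin n) (Fin n) ℝ} (hσ : IsUnit σ.det)
    (x : E n) :
    Matrix.toEuclideanCLM (𝕜 := ℝ) σ⁻¹ (Matrix.toEuclideanCLM (𝕜 := ℝ) σ x) = x := by
  have h := DFunLike.congr_fun (map_mul (Matrix.toEuclideanCLM (n := Fin n) (𝕜 := ℝ)) σ⁻¹ σ) x
  rw [Matrix.nonsing_inv_mul _ hσ, map_one] at h
  exact h.symm

/-- The linear map `c^{-1/2} σ⁻¹`, which whitens the Gaussian law `N(0, c σ²)`. -/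
def whitening (σ : Matrix (Fin n) (Fin n) ℝ) (c : ℝ) : E n →L[ℝ] E n :=
  (Real.sqrt c)⁻¹ • Matrix.toEuclideanCLM (𝕜 := ℝ) σ⁻¹

theorem multivariateGaussian_eq_withDensity {σ : Matrix (Fin n) (Fin n) ℝ} (hσ : σ.PosDef) {c : ℝ}
    (hc : 0 < c) :
    ∃ K : ℝ, 0 < K ∧ multivariateGaussian 0 (c • (σ * σ)) =
      volume.withDensity (fun x => ENNReal.ofReal (K * Real.exp (-‖whitening σ c x‖ ^ 2 / 2))) := by
  have hdet : IsUnit σ.det := hσ.det_pos.ne'.isUnit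
  have hsq : Real.sqrt c ≠ 0 := (Real.sqrt_pos.2 hc).ne'
  set A : E n →L[ℝ] E n := Real.sqrt c • Matrix.toEuclideanCLM (𝕜 := ℝ) σ with hA
  have h1 (x) : A (whitening σ c x) = x := by
    simp only [hA, whitening, _root_.smul_apply, map_smul, smul_smul, inv_mul_cancel₀ hsq,
      one_smul, toEuclideanCLM_apply_inv_apply hdet]
  have h2 (x) : whitening σ c (A x) = x := by
    simp only [hA, whitening, _root_.smul_apply, map_smul, smul_smul, mul_inv_cancel₀ hsq,
      one_smul, toEuclideanCLM_inv_apply_apply hdet]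
  obtain ⟨K, hK, h⟩ := map_stdGaussian_eq_withDensity A (whitening σ c) h1 h2
  refine ⟨K, hK, ?_⟩
  rw [← h]
  have hps : (σ * σ).PosSemidef := by
    have := Matrix.posSemidef_conjTranspose_mul_self σ
    rwa [hσ.isHermitian.eq] at this
  have : IsFiniteMeasure ((stdGaussian (E n)).map A) := by infer_instance
  refine Measure.ext_of_charFun ?_
  ext x
  have hself : IsSelfAdjoint A := by
    rw [hA]
    refine IsSelfAdjoint.smul (by simp [IsSelfAdjoint]) ?_
    have : IsSelfAdjoint σ := hσ.isHermitian
    exact this.map _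
  have hadj (u v : E n) : ⟪A u, v⟫ = ⟪u, A v⟫ := by
    rw [← ContinuousLinearMap.adjoint_inner_left, hself.adjoint_eq]
  have hnorm : ‖A x‖ ^ 2 = x.ofLp ⬝ᵥ (c • (σ * σ)).mulVec x.ofLp := by
    rw [← real_inner_self_eq_norm_sq, hadj, ← Matrix.inner_toEuclideanCLM, map_smul, map_mul]
    simp only [hA, _root_.smul_apply, map_smul, smul_smul, Real.mul_self_sqrt hc.le]
    rfl
  have h3 : charFun ((stdGaussian (E n)).map A) x = charFun (stdGaussian (E n)) (A x) := by
    rw [charFun_apply, charFun_apply, integral_map A.measurable.aemeasurable (by fun_prop)]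
    simp only [hadj]
  rw [charFun_multivariateGaussian (hps.smul hc.le), h3, charFun_stdGaussian, ← hnorm]
  simp [neg_div]

end Matrix

/-! ### Gaussian smoothing of measures -/

section GaussianSmoothing

variable {F : Type*} [NormedAddCommGroup F] [InnerProductSpace ℝ F] [MeasurableSpace F]

/-- The convolution of the measure `α` with the Gaussian function `z ↦ exp (-‖M z‖² / 2)`. -/
def gaussSmooth (M : F →L[ℝ] F) (α : Measure F) (z : F) : ℝ :=
  ∫ u, Real.exp (-‖M (z - u)‖ ^ 2 / 2) ∂α

variable [FiniteDimensional ℝ F] [BorelSpace F]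

theorem integrable_gauss (M : F →L[ℝ] F) (α : Measure F) [IsFiniteMeasure α] (z : F) :
    Integrable (fun u => Real.exp (-‖M (z - u)‖ ^ 2 / 2)) α := by
  refine Integrable.of_bound (by fun_prop) 1 (ae_of_all _ fun u => ?_)
  rw [Real.norm_of_nonneg (Real.exp_pos _).le, Real.exp_le_one_iff]
  have := sq_nonneg ‖M (z - u)‖
  linarith

theorem gaussSmooth_pos (M : F →L[ℝ] F) {α : Measure F} [IsFiniteMeasure α] (hα : α ≠ 0) (z : F) :
    0 < gaussSmooth M α z := by
  rw [gaussSmooth, integral_pos_iff_support_of_nonneg (fun x => (Real.exp_pos _).le)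
      (integrable_gauss M α z)]
  have : Function.support (fun u : F => Real.exp (-‖M (z - u)‖ ^ 2 / 2)) = univ := by
    ext x; simp
  rw [this]
  exact Measure.measure_univ_pos.2 hα

/-- Fourier transforms with respect to a Gaussian measure are smooth, because it has moments of
all orders. -/
theorem contDiff_integral_mul_exp_inner {f : F → ℂ} (hf : Continuous f) {C : ℝ}
    (hC : ∀ w, ‖f w‖ ≤ C) :
    ContDiff ℝ (⊤ : ℕ∞)
      (fun t : F => ∫ w, Complex.exp (⟪w, t⟫ * Complex.I) * f w ∂(stdGaussian F)) := by
  have h : (fun t : F => ∫ w, Complex.exp (⟪w, t⟫ * Complex.I) * f w ∂(stdGaussian F)) =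
      fun t => VectorFourier.fourierIntegral Real.fourierChar (stdGaussian F)
        (innerSL ℝ).toLinearMap₁₂ f (-((2 * Real.pi)⁻¹ • t)) := by
    ext t
    simp only [VectorFourier.fourierIntegral]
    refine integral_congr_ae (ae_of_all _ fun w => ?_)
    simp only [Circle.smul_def, smul_eq_mul, Real.fourierChar_apply]
    congr 3
    simp only [innerSL_apply_apply, ContinuousLinearMap.toLinearMap₁₂_apply_apply_apply, map_neg,
      neg_neg, map_smul, smul_eq_mul]
    field_simp
  rw [h]
  refine (VectorFourier.contDiff_fourierIntegral (L := innerSL ℝ) fun k _ => ?_).comp (by fun_prop)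
  have h1 : Integrable (fun w : F => ‖w‖ ^ k) (stdGaussian F) :=
    (IsGaussian.memLp_id (stdGaussian F) k (by simp)).integrable_norm_pow'
  refine (h1.mul_const C).mono' (by fun_prop) (ae_of_all _ fun w => ?_)
  rw [Real.norm_of_nonneg (by positivity)]
  exact mul_le_mul_of_nonneg_left (hC w) (by positivity)

/-- The Gaussian function is the Fourier transform of a Gaussian measure, so that Gaussian smoothing
is a Fourier transform as well. -/
theorem contDiff_gaussSmooth (M : F →L[ℝ] F) (α : Measure F) [IsFiniteMeasure α] :
    ContDiff ℝ (⊤ : ℕ∞) (gaussSmooth M α) := by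
  -- `gaussSmooth M α` is the Fourier transform of `f` for the Gaussian measure, at `M z`
  set f : F → ℂ := fun w => charFun (α.map M) (-w) with hf
  have hfc : Continuous f := continuous_charFun.comp continuous_neg
  have h := (contDiff_integral_mul_exp_inner hfc (C := (α.map M).real univ)
    (fun w => norm_charFun_le _)).comp M.contDiff
  have h2 := Complex.reCLM.contDiff.comp h
  convert h2 using 1
  ext z
  have key : ((gaussSmooth M α z : ℝ) : ℂ) =
      ∫ w, Complex.exp (⟪w, M z⟫ * Complex.I) * f w ∂(stdGaussian F) := by
    rw [gaussSmooth, ← integral_complex_ofReal]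
    have h3 : ∀ u, ((Real.exp (-‖M (z - u)‖ ^ 2 / 2) : ℝ) : ℂ) =
        ∫ w, Complex.exp (⟪w, M (z - u)⟫ * Complex.I) ∂(stdGaussian F) := fun u => by
      rw [← charFun_apply, charFun_stdGaussian]
      push_cast
      rfl
    simp only [h3]
    rw [integral_integral_swap]
    · refine integral_congr_ae (ae_of_all _ fun w => ?_)
      simp only [hf]
      rw [charFun_apply, integral_map M.measurable.aemeasurable (by fun_prop),
        ← integral_const_mul]
      refine integral_congr_ae (ae_of_all _ fun u => ?_)
      simp only
      rw [← Complex.exp_add]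
      congr 1
      rw [map_sub, inner_sub_right, inner_neg_right, real_inner_comm w (M u)]
      push_cast
      ring
    · refine Integrable.of_bound (C := 1) ?_ (ae_of_all _ fun p => ?_)
      · exact Continuous.aestronglyMeasurable (by fun_prop)
      · simp [Function.uncurry, Complex.norm_exp_ofReal_mul_I]
  simp only [Function.comp_apply, Complex.reCLM_apply]
  rw [← key, Complex.ofReal_re]

/-- Along a line, Gaussian smoothing is a Gaussian factor times a moment generating function, which
is finite everywhere. -/
theorem analyticAt_gaussSmooth_line (M : F →L[ℝ] F) (α : Measure F) [IsFiniteMeasure α]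
    (z d : F) (τ : ℝ) : AnalyticAt ℝ (fun r : ℝ => gaussSmooth M α (z + r • d)) τ := by
  set X : F → ℝ := fun u => -⟪M (z - u), M d⟫ with hX
  set ν := α.withDensity (fun u => ENNReal.ofReal (Real.exp (-‖M (z - u)‖ ^ 2 / 2))) with hν
  have hexp (r : ℝ) (u : F) : Real.exp (-‖M (z + r • d - u)‖ ^ 2 / 2) =
      Real.exp (-(r ^ 2 * ‖M d‖ ^ 2) / 2) *
        (Real.exp (-‖M (z - u)‖ ^ 2 / 2) * Real.exp (r * X u)) := by
    rw [← Real.exp_add, ← Real.exp_add]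
    congr 1
    have : z + r • d - u = (z - u) + r • d := by abel
    rw [this, map_add, map_smul, norm_add_sq_real, norm_smul, inner_smul_right, mul_pow,
      Real.norm_eq_abs, sq_abs]
    ring
  have hmgf (r : ℝ) : gaussSmooth M α (z + r • d) =
      Real.exp (-(r ^ 2 * ‖M d‖ ^ 2) / 2) * mgf X ν r := by
    rw [gaussSmooth, mgf, hν, integral_withDensity_eq_integral_toReal_smul (by fun_prop)
      (ae_of_all _ fun x => by simp), ← integral_const_mul]
    refine integral_congr_ae (ae_of_all _ fun u => ?_)
    simp only
    rw [ENNReal.toReal_ofReal (Real.exp_pos _).le, smul_eq_mul, hexp]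
  have hset : integrableExpSet X ν = univ := by
    refine eq_univ_of_forall fun r => ?_
    rw [integrableExpSet, mem_ofPred_eq, hν, integrable_withDensity_iff_integrable_smul₀'
      (by fun_prop) (ae_of_all _ fun x => by simp)]
    have h1 := (integrable_gauss M α (z + r • d)).const_mul (Real.exp (r ^ 2 * ‖M d‖ ^ 2 / 2))
    refine h1.congr (ae_of_all _ fun u => ?_)
    simp only
    rw [ENNReal.toReal_ofReal (Real.exp_pos _).le, smul_eq_mul, hexp, ← mul_assoc, ← Real.exp_add]
    have : r ^ 2 * ‖M d‖ ^ 2 / 2 + -(r ^ 2 * ‖M d‖ ^ 2) / 2 = 0 := by ring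
    rw [this, Real.exp_zero, one_mul]
  simp only [hmgf]
  refine AnalyticAt.mul ?_ (analyticAt_mgf (by rw [hset]; simp))
  exact AnalyticAt.rexp (by fun_prop)

end GaussianSmoothing

/-! ### Densities of measures smoothed in one coordinate -/

section SmoothDisintegration

/-- The regularity of the densities of Gaussian convolutions which is used below: smoothness,
analyticity along lines, and the dichotomy between vanishing identically and being positive. -/
structure IsSmoothProfile {F : Type*} [NormedAddCommGroup F] [NormedSpace ℝ F] (g : F → ℝ) :
    Prop where
  contDiff : ContDiff ℝ (⊤ : ℕ∞) g
  analyticAt_line : ∀ (z d : F) (τ : ℝ), AnalyticAt ℝ (fun r : ℝ => g (z + r • d)) τ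
  zero_or_pos : (∀ z, g z = 0) ∨ ∀ z, 0 < g z

variable {n : ℕ}

theorem IsSmoothProfile.const_mul_gaussSmooth (M : E n →L[ℝ] E n) (α : Measure (E n))
    [IsFiniteMeasure α] {c : ℝ} (hc : 0 ≤ c) :
    IsSmoothProfile (fun z => c * gaussSmooth M α z) where
  contDiff := contDiff_const.mul (contDiff_gaussSmooth M α)
  analyticAt_line z d τ := analyticAt_const.mul (analyticAt_gaussSmooth_line M α z d τ)
  zero_or_pos := by
    rcases hc.eq_or_lt with rfl | hc
    · simp
    · by_cases hα : α = 0
      · exact Or.inl fun z => by simp [hα, gaussSmooth]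
      · exact Or.inr fun z => mul_pos hc (gaussSmooth_pos M hα z)

/-- The disintegration of a measure on `ℝⁿ × ℝⁿ` along its second coordinate. -/
def sndDisintegration (α : Measure (E n × E n)) [IsFiniteMeasure α] : Kernel (E n) (E n) :=
  (α.map Prod.swap).condKernel

instance (α : Measure (E n × E n)) [IsFiniteMeasure α] : IsMarkovKernel (sndDisintegration α) := by
  unfold sndDisintegration; infer_instance

theorem lintegral_eq_sndDisintegration (α : Measure (E n × E n)) [IsFiniteMeasure α]
    {f : E n × E n → ENNReal} (hf : Measurable f) :
    ∫⁻ x, f x ∂α = ∫⁻ s, ∫⁻ u, f (u, s) ∂(sndDisintegration α s) ∂α.snd := by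
  have h : (α.map Prod.swap).fst ⊗ₘ (α.map Prod.swap).condKernel = α.map Prod.swap :=
    (α.map Prod.swap).disintegrate _
  have h2 : ∫⁻ x, f x ∂α = ∫⁻ x, f x.swap ∂(α.map Prod.swap) := by
    rw [lintegral_map (f := fun x : E n × E n => f x.swap) (hf.comp measurable_swap)
      measurable_swap]
    rfl
  rw [h2, ← h, Measure.lintegral_compProd (f := fun x : E n × E n => f x.swap)
    (hf.comp measurable_swap), Measure.fst_map_swap]
  rfl

theorem measurable_gaussSmooth_kernel (M : E n →L[ℝ] E n) (κ : Kernel (E n) (E n))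
    [IsMarkovKernel κ] : Measurable fun x : E n × E n => gaussSmooth M (κ x.2) x.1 := by
  have h : StronglyMeasurable
      (fun p : (E n × E n) × E n => Real.exp (-‖M (p.1.1 - p.2)‖ ^ 2 / 2)) :=
    Continuous.stronglyMeasurable (by fun_prop)
  exact (h.integral_kernel_prod_right' (κ := κ.comap Prod.snd measurable_snd)).measurable

theorem lintegral_conv_liftFst (α : Measure (E n × E n)) [IsFiniteMeasure α]
    {M : E n →L[ℝ] E n} {K : ℝ} (hK : 0 < K) {N : Measure (E n)} [IsFiniteMeasure N]
    (hN : N = volume.withDensity fun x => ENNReal.ofReal (K * Real.exp (-‖M x‖ ^ 2 / 2)))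
    {f : E n × E n → ENNReal} (hf : Measurable f) :
    ∫⁻ x, f x ∂(α ∗ liftFst N) =
      ∫⁻ s, (∫⁻ z, ENNReal.ofReal (K * gaussSmooth M (sndDisintegration α s) z) * f (z, s))
        ∂α.snd := by
  set φ : E n → ENNReal := fun x => ENNReal.ofReal (K * Real.exp (-‖M x‖ ^ 2 / 2)) with hφ
  have hφm : Measurable φ := by fun_prop
  have h1 (x : E n × E n) : ∫⁻ y, f (x + y) ∂(liftFst N) = ∫⁻ z, φ (z - x.1) * f (z, x.2) := by
    rw [liftFst, lintegral_map (by fun_prop) (by fun_prop), hN,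
      lintegral_withDensity_eq_lintegral_mul _ hφm (by fun_prop),
      ← lintegral_sub_right_eq_self _ x.1]
    refine lintegral_congr fun z => ?_
    have : x + (z - x.1, 0) = (z, x.2) := by ext1 <;> simp
    simp [this]
  have h2 : Measurable fun x : E n × E n => ∫⁻ z, φ (z - x.1) * f (z, x.2) := by
    refine Measurable.lintegral_prod_right' (f := fun p : (E n × E n) × E n =>
      φ (p.2 - p.1.1) * f (p.2, p.1.2)) (by fun_prop)
  rw [Measure.lintegral_conv hf]
  simp only [h1]
  rw [lintegral_eq_sndDisintegration α h2]
  refine lintegral_congr fun s => ?_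
  rw [lintegral_lintegral_swap (by fun_prop)]
  refine lintegral_congr fun z => ?_
  simp only
  rw [lintegral_mul_const _ (by fun_prop)]
  congr 1
  simp only [hφ]
  rw [← ofReal_integral_eq_lintegral_ofReal
    ((integrable_gauss M _ z).const_mul K) (ae_of_all _ fun u => by positivity),
    integral_const_mul]
  rfl

/-- Convolutions of finitely many measures with Gaussian laws in the first coordinate have
densities, with respect to a common reference measure `dz ⊗ lam(ds)`, which are smooth profiles in
`z` for *every* `s`. -/
theorem exists_smooth_densities {ι : Type*} [Fintype ι] (α : ι → Measure (E n × E n))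
    [∀ i, IsFiniteMeasure (α i)] {M : ι → E n →L[ℝ] E n} {K : ι → ℝ} (hK : ∀ i, 0 < K i)
    {N : ι → Measure (E n)} [∀ i, IsFiniteMeasure (N i)]
    (hN : ∀ i, N i = volume.withDensity fun x =>
      ENNReal.ofReal (K i * Real.exp (-‖M i x‖ ^ 2 / 2))) :
    ∃ (lam : Measure (E n)) (h : ι → E n × E n → ℝ), IsFiniteMeasure lam ∧
      (∀ i, Measurable (h i)) ∧ (∀ i s, IsSmoothProfile fun z => h i (z, s)) ∧
      ∀ i, α i ∗ liftFst (N i) =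
        (volume.prod lam).withDensity fun x => ENNReal.ofReal (h i x) := by
  -- the sum of the second marginals dominates each of them
  set lam : Measure (E n) := ∑ i, (α i).snd with hlam
  have hfin : IsFiniteMeasure lam := by
    rw [hlam]; infer_instance
  have hac (i) : (α i).snd ≪ lam := by
    refine Measure.absolutelyContinuous_of_le ?_
    classical
    rw [hlam, ← Finset.add_sum_erase _ _ (Finset.mem_univ i)]
    exact Measure.le_add_right le_rfl
  set a : ι → E n → ENNReal := fun i => (α i).snd.rnDeriv lam with ha
  set h : ι → E n × E n → ℝ := fun i x =>
    (a i x.2).toReal * K i * gaussSmooth (M i) (sndDisintegration (α i) x.2) x.1 with hh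
  have hm (i) : Measurable (h i) := by
    have h1 := measurable_gaussSmooth_kernel (M i) (sndDisintegration (α i))
    have h2 : Measurable (a i) := Measure.measurable_rnDeriv _ _
    fun_prop
  refine ⟨lam, h, hfin, hm, fun i s => ?_, fun i => ?_⟩
  · have h1 : 0 ≤ (a i s).toReal * K i := mul_nonneg ENNReal.toReal_nonneg (hK i).le
    exact IsSmoothProfile.const_mul_gaussSmooth (M i) (sndDisintegration (α i) s) h1
  · refine Measure.ext_of_lintegral _ fun f hf => ?_
    have hgm := measurable_gaussSmooth_kernel (M i) (sndDisintegration (α i))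
    rw [lintegral_conv_liftFst (α i) (hK i) (hN i) hf,
      lintegral_withDensity_eq_lintegral_mul _ (by fun_prop) hf,
      lintegral_prod_symm' _ (by fun_prop)]
    have hgs (s) : Measurable (gaussSmooth (M i) (sndDisintegration (α i) s)) :=
      (contDiff_gaussSmooth _ _).continuous.measurable
    conv_lhs => rw [← Measure.withDensity_rnDeriv_eq _ _ (hac i)]
    rw [lintegral_withDensity_eq_lintegral_mul _ (Measure.measurable_rnDeriv _ _)]
    · refine lintegral_congr_ae ?_
      filter_upwards [Measure.rnDeriv_lt_top (α i).snd lam] with s hs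
      simp only [Pi.mul_apply]
      rw [← lintegral_const_mul _ (by fun_prop)]
      refine lintegral_congr fun z => ?_
      simp only [hh, ha]
      rw [mul_assoc, ENNReal.ofReal_mul ENNReal.toReal_nonneg, ENNReal.ofReal_toReal hs.ne,
        mul_assoc]
    · exact Measurable.lintegral_prod_right' (f := fun p : E n × E n =>
        ENNReal.ofReal (K i * gaussSmooth (M i) (sndDisintegration (α i) p.1) p.2) * f (p.2, p.1))
        ((((hgm.comp measurable_swap).const_mul (K i)).ennreal_ofReal).mul
          (hf.comp measurable_swap))

end SmoothDisintegration

/-! ### Positivity and recovery of a point from its likelihood ratios -/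

section Fiber

/-- A nonnegative analytic function which does not vanish identically behaves like
`exp c * τ ^ k` as `τ ↓ 0`. -/
theorem exists_tendsto_log_sub_mul_log {f : ℝ → ℝ} (hf : AnalyticAt ℝ f 0)
    (hne : ¬ ∀ᶠ τ in 𝓝 0, f τ = 0) (h0 : ∀ τ, 0 ≤ f τ) :
    ∃ (k : ℕ) (c : ℝ), (∀ᶠ τ in 𝓝[>] (0 : ℝ), 0 < f τ) ∧
      Tendsto (fun τ => Real.log (f τ) - k * Real.log τ) (𝓝[>] 0) (𝓝 c) ∧ (k = 0 → 0 < f 0) := by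
  obtain ⟨k, u, hu, hu0, hfu⟩ := (hf.exists_eventuallyEq_pow_smul_nonzero_iff).2 hne
  simp only [sub_zero, smul_eq_mul] at hfu
  have hfu' : ∀ᶠ τ in 𝓝[>] (0 : ℝ), f τ = τ ^ k * u τ := hfu.filter_mono nhdsWithin_le_nhds
  have hpos : ∀ᶠ τ in 𝓝[>] (0 : ℝ), 0 < τ := self_mem_nhdsWithin
  have hune : ∀ᶠ τ in 𝓝[>] (0 : ℝ), u τ ≠ 0 :=
    (hu.continuousAt.eventually_ne hu0).filter_mono nhdsWithin_le_nhds
  have hutend : Tendsto u (𝓝[>] 0) (𝓝 (u 0)) := hu.continuousAt.mono_left nhdsWithin_le_nhds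
  refine ⟨k, Real.log (u 0), ?_, ?_, ?_⟩
  · filter_upwards [hfu', hpos, hune] with τ h1 h2 h3
    refine (h0 τ).lt_of_ne' ?_
    rw [h1]
    positivity
  · refine ((Real.continuousAt_log hu0).tendsto.comp hutend).congr' ?_
    filter_upwards [hfu', hpos, hune] with τ h1 h2 h3
    simp only [Function.comp_apply]
    rw [h1, Real.log_mul (by positivity) h3, Real.log_pow]
    ring
  · rintro rfl
    refine (h0 0).lt_of_ne' ?_
    rw [hfu.self_of_nhds]
    simpa using hu0

theorem log_likelihood_ratio {C q e₀ e₁ : ℝ} (hC : 0 < C) (hq : 0 < q) :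
    Real.log (C * Real.exp e₁ * q) - Real.log (C * Real.exp e₀ * q) = e₁ - e₀ := by
  rw [Real.log_mul (by positivity) hq.ne', Real.log_mul (by positivity) hq.ne',
    Real.log_mul hC.ne' (by positivity), Real.log_mul hC.ne' (by positivity), Real.log_exp,
    Real.log_exp]
  ring

variable {F : Type*} [NormedAddCommGroup F] [InnerProductSpace ℝ F] {ι : Type*}

/-- The point `v` whose log-likelihood ratios
`a / 2 * (‖v - η none‖² - ‖v - η (some i)‖²)` are `l i`; here `Φ v i = ⟪v, η (some i) - η none⟫`. -/
def decode (Φ : F ≃L[ℝ] (ι → ℝ)) (a : ℝ) (η : Option ι → F) (l : ι → ℝ) : F :=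
  Φ.symm (fun i => a⁻¹ * l i + (‖η (some i)‖ ^ 2 - ‖η none‖ ^ 2) / 2)

theorem eq_decode {Φ : F ≃L[ℝ] (ι → ℝ)} {a : ℝ} (ha : 0 < a) {η : Option ι → F}
    (hΦ : ∀ v i, Φ v i = ⟪v, η (some i) - η none⟫) {v : F} {l : ι → ℝ}
    (h : ∀ i, l i = a / 2 * (‖v - η none‖ ^ 2 - ‖v - η (some i)‖ ^ 2)) : v = decode Φ a η l := by
  rw [decode, ContinuousLinearEquiv.eq_symm_apply]
  ext i
  rw [hΦ, h i, norm_sub_sq_real, norm_sub_sq_real, inner_sub_right]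
  field_simp
  ring

variable [Fintype ι]

theorem contDiff_decode (Φ : F ≃L[ℝ] (ι → ℝ)) (a : ℝ) (η : Option ι → F) :
    ContDiff ℝ (⊤ : ℕ∞) (decode Φ a η) := by
  refine Φ.symm.contDiff.comp (contDiff_pi.2 fun i => ?_)
  fun_prop

variable [FiniteDimensional ℝ F] [MeasurableSpace F] [BorelSpace F]

/-- If, almost everywhere, `g i = W_i(v) q` with the Gaussian likelihood ratios
`W_i(v) = C exp (-a / 2 ‖v - η i‖² + b / 2 ‖v‖²)`, `b < a`, and if the `g i` are continuous and
analytic along lines, then the `g i` are positive *everywhere*, and `v` is almost everywhere equal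
to the continuous function of the `g i` given by `decode`. -/
theorem pos_and_eq_decode_of_ae_eq {a b C : ℝ} (ha : 0 < a) (hba : b < a) (hC : 0 < C)
    {η : Option ι → F} {Φ : F ≃L[ℝ] (ι → ℝ)} (hΦ : ∀ v i, Φ v i = ⟪v, η (some i) - η none⟫)
    {q : F → ℝ} (hq : Continuous q) (hqpos : ∀ z, 0 < q z) {g : Option ι → F → ℝ}
    (hg : ∀ i, Continuous (g i))
    (hline : ∀ i (z d : F) (τ : ℝ), AnalyticAt ℝ (fun r : ℝ => g i (z + r • d)) τ)
    {v : F → F}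
    (hae : ∀ᵐ z, ∀ i, g i z =
      C * Real.exp (-(a / 2) * ‖v z - η i‖ ^ 2 + b / 2 * ‖v z‖ ^ 2) * q z) :
    (∀ i z, 0 < g i z) ∧
      ∀ᵐ z, v z = decode Φ a η (fun i => Real.log (g (some i) z) - Real.log (g none z)) := by
  set l : F → ι → ℝ := fun z i => Real.log (g (some i) z) - Real.log (g none z) with hl
  have hdec : ∀ᵐ z, v z = decode Φ a η (l z) := by
    filter_upwards [hae] with z hz
    refine eq_decode ha hΦ fun i => ?_
    simp only [hl]
    rw [hz, hz, log_likelihood_ratio hC (hqpos z)]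
    ring
  refine ⟨?_, hdec⟩
  have haepos : ∀ᵐ z, ∀ i, 0 < g i z := by
    filter_upwards [hae] with z hz i
    rw [hz]
    have := hqpos z
    positivity
  have hnonneg (i z) : 0 ≤ g i z := by
    have h1 : (fun z => max (g i z) 0) = g i := by
      rw [← Continuous.ae_eq_iff_eq (volume : Measure F) ((hg i).max continuous_const) (hg i)]
      filter_upwards [haepos] with z hz
      exact max_eq_left (hz i).le
    rw [← h1]
    exact le_max_right _ _
  set U : Set F := {z | ∀ i, 0 < g i z} with hU
  have hUo : IsOpen U := by
    rw [hU, ofPred_forall]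
    exact isOpen_iInter_of_finite fun i => isOpen_lt continuous_const (hg i)
  have hlogc (i) : ContinuousOn (fun z => Real.log (g i z)) U :=
    (hg i).continuousOn.log fun z hz => (hz i).ne'
  have hlc : ContinuousOn l U := continuousOn_pi.2 fun i => (hlogc _).sub (hlogc _)
  have hVc : ContinuousOn (fun z => decode Φ a η (l z)) U :=
    (contDiff_decode Φ a η).continuous.comp_continuousOn hlc
  -- `v` is determined by the ratios, so that `g none` is a function of them
  have hident : EqOn (fun z => Real.log (g none z) - Real.log (q z))
      (fun z => Real.log C + (-(a / 2) * ‖decode Φ a η (l z) - η none‖ ^ 2 +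
        b / 2 * ‖decode Φ a η (l z)‖ ^ 2)) U := by
    refine Measure.eqOn_open_of_ae_eq (μ := (volume : Measure F)) (ae_restrict_of_ae ?_) hUo
      ((hlogc none).sub (hq.log fun z => (hqpos z).ne').continuousOn) (by fun_prop)
    filter_upwards [hae, hdec] with z hz hv
    have := hqpos z
    rw [← hv, hz none, Real.log_mul (by positivity) this.ne', Real.log_mul hC.ne' (by positivity),
      Real.log_exp]
    ring
  -- join a given point `z₀` to a point `z₁` of positivity by a line
  obtain ⟨z₁, hz₁⟩ := haepos.exists
  intro i₀ z₀
  set γ : ℝ → F := fun r => z₀ + r • (z₁ - z₀) with hγ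
  have hγ0 : γ 0 = z₀ := by simp [hγ]
  have hγ1 : γ 1 = z₁ := by simp [hγ]
  have hγc : Continuous γ := by fun_prop
  have hord (i) := exists_tendsto_log_sub_mul_log (f := fun r => g i (γ r)) (hline i _ _ 0)
    (fun h => by
      have h1 : AnalyticOnNhd ℝ (fun r => g i (γ r)) univ := fun τ _ => hline i _ _ τ
      have h2 := h1.eqOn_zero_of_preconnected_of_eventuallyEq_zero isPreconnected_univ
        (mem_univ 0) h (mem_univ 1)
      simp only [Pi.zero_apply, hγ1] at h2
      exact (hz₁ i).ne' h2) (fun τ => hnonneg i _)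
  choose k c hpos htend hk using hord
  -- `L τ` tends to infinity at `0`, and `log (g i (γ τ)) = -k i * L τ + c i + o(1)`
  set L : ℝ → ℝ := fun τ => -Real.log τ with hL
  have hLtop : Tendsto L (𝓝[>] 0) atTop := tendsto_neg_atBot_atTop.comp Real.tendsto_log_nhdsGT_zero
  have hLinv : Tendsto (fun τ => (L τ)⁻¹) (𝓝[>] 0) (𝓝 0) := tendsto_inv_atTop_zero.comp hLtop
  have hLpos : ∀ᶠ τ in 𝓝[>] 0, 0 < L τ := hLtop.eventually_gt_atTop 0
  have hγU : ∀ᶠ τ in 𝓝[>] 0, γ τ ∈ U := by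
    rw [hU]
    exact eventually_all.2 hpos
  have hlogdiv (i) : Tendsto (fun τ => (L τ)⁻¹ * Real.log (g i (γ τ))) (𝓝[>] 0) (𝓝 (-(k i))) := by
    have h1 := (hLinv.mul (htend i)).sub_const (k i : ℝ)
    rw [zero_mul, zero_sub] at h1
    refine h1.congr' ?_
    filter_upwards [hLpos] with τ hτ
    have : Real.log τ = -L τ := by simp [hL]
    rw [this]
    field_simp
    ring
  have hqlim : Tendsto (fun τ => Real.log (q (γ τ))) (𝓝[>] 0) (𝓝 (Real.log (q z₀))) := by
    have : Continuous fun τ => Real.log (q (γ τ)) := (hq.comp hγc).log fun z => (hqpos _).ne'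
    have h2 := (this.tendsto 0).mono_left (nhdsWithin_le_nhds (s := Ioi 0))
    rwa [hγ0] at h2
  -- divided by `(log τ)²`, the identity says that the leading coefficient of `v` vanishes
  set w : F := Φ.symm (fun i => a⁻¹ * (-(k (some i) : ℝ) - -(k none : ℝ))) with hw
  have hVdiv : Tendsto (fun τ => (L τ)⁻¹ • decode Φ a η (l (γ τ))) (𝓝[>] 0) (𝓝 w) := by
    have h1 : Tendsto (fun τ => fun i => a⁻¹ * ((L τ)⁻¹ * Real.log (g (some i) (γ τ)) -
        (L τ)⁻¹ * Real.log (g none (γ τ))) +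
          (L τ)⁻¹ * ((‖η (some i)‖ ^ 2 - ‖η none‖ ^ 2) / 2)) (𝓝[>] 0)
        (𝓝 fun i => a⁻¹ * (-(k (some i) : ℝ) - -(k none : ℝ))) := by
      refine tendsto_pi_nhds.2 fun i => ?_
      have h2 := (((hlogdiv (some i)).sub (hlogdiv none)).const_mul a⁻¹).add
        (hLinv.mul_const ((‖η (some i)‖ ^ 2 - ‖η none‖ ^ 2) / 2))
      rwa [zero_mul, add_zero] at h2
    refine ((Φ.symm.continuous.tendsto _).comp h1).congr fun τ => ?_
    simp only [Function.comp_apply, decode, ← map_smul]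
    congr 1
    ext i
    simp only [Pi.smul_apply, smul_eq_mul, hl]
    ring
  have hw0 : w = 0 := by
    have h1 : Tendsto (fun τ => (L τ)⁻¹ * ((L τ)⁻¹ * Real.log (g none (γ τ)) -
        (L τ)⁻¹ * Real.log (q (γ τ)))) (𝓝[>] 0) (𝓝 0) := by
      have := hLinv.mul ((hlogdiv none).sub (hLinv.mul hqlim))
      rwa [zero_mul] at this
    have h2 : Tendsto (fun τ => (L τ)⁻¹ * ((L τ)⁻¹ * Real.log C) +
        (-(a / 2) * ‖(L τ)⁻¹ • decode Φ a η (l (γ τ)) - (L τ)⁻¹ • η none‖ ^ 2 +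
          b / 2 * ‖(L τ)⁻¹ • decode Φ a η (l (γ τ))‖ ^ 2)) (𝓝[>] 0)
        (𝓝 (-(a / 2) * ‖w‖ ^ 2 + b / 2 * ‖w‖ ^ 2)) := by
      have := (hLinv.mul (hLinv.mul_const (Real.log C))).add
        (((((hVdiv.sub (hLinv.smul_const (η none))).norm).pow 2).const_mul (-(a / 2))).add
          ((hVdiv.norm.pow 2).const_mul (b / 2)))
      simpa using this
    have h3 := tendsto_nhds_unique (h1.congr' ?_) h2
    · have h4 : (a - b) / 2 * ‖w‖ ^ 2 = 0 := by linarith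
      have h5 : ‖w‖ ^ 2 = 0 := (mul_eq_zero.1 h4).resolve_left (by linarith)
      simpa using h5
    · filter_upwards [hγU] with τ hτ
      have h4 := hident hτ
      simp only at h4
      rw [← mul_sub, h4, ← smul_sub, norm_smul, norm_smul, mul_pow, mul_pow, norm_inv,
        Real.norm_eq_abs, inv_pow, sq_abs]
      ring
  have hkeq (i) : k (some i) = k none := by
    have h1 : (fun i => a⁻¹ * (-(k (some i) : ℝ) - -(k none : ℝ))) = 0 := by
      rw [hw] at hw0
      simpa using hw0
    have h2 := congrFun h1 i
    simp only [Pi.zero_apply, mul_eq_zero, inv_eq_zero, ha.ne', false_or] at h2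
    have : (k (some i) : ℝ) = k none := by linarith
    exact_mod_cast this
  -- hence `v` stays bounded along the line, and so does `log (g none)`
  have hk0 : k none = 0 := by
    have h1 : Tendsto (fun τ => l (γ τ)) (𝓝[>] 0) (𝓝 fun i => c (some i) - c none) := by
      refine tendsto_pi_nhds.2 fun i => ((htend (some i)).sub (htend none)).congr fun τ => ?_
      simp only [hl, hkeq i]
      ring
    have h2 := ((contDiff_decode Φ a η).continuous.tendsto _).comp h1
    have h3 := (((((h2.sub_const (η none)).norm).pow 2).const_mul (-(a / 2))).add
          ((h2.norm.pow 2).const_mul (b / 2))).const_add (Real.log C)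
    have h4 := (htend none).sub (h3.add hqlim)
    by_contra hne
    have h5 : Tendsto (fun τ => (k none : ℝ) * L τ) (𝓝[>] 0) atTop :=
      hLtop.const_mul_atTop (by exact_mod_cast Nat.pos_of_ne_zero hne)
    refine not_tendsto_nhds_of_tendsto_atTop h5 _ (h4.congr' ?_)
    filter_upwards [hγU] with τ hτ
    have h6 := hident hτ
    simp only [Function.comp_apply] at h6 ⊢
    rw [← h6]
    simp only [hL]
    ring
  have hki : k i₀ = 0 := by
    cases i₀ with
    | none => exact hk0
    | some i => rw [hkeq, hk0]
  have := hk i₀ hki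
  simpa only [hγ0] using this

end Fiber

/-! ### The law of the state -/

section Market

theorem indepFun_prodMk_of_indepFun {Ω α β γ : Type*} [MeasurableSpace Ω] [MeasurableSpace α]
    [MeasurableSpace β] [MeasurableSpace γ] {P : Measure Ω} [IsProbabilityMeasure P]
    {X : Ω → α} {Z : Ω → β} {W : Ω → γ} (hX : Measurable X) (hZ : Measurable Z)
    (hW : Measurable W) (hXZW : IndepFun X (fun ω => (Z ω, W ω)) P) (hZW : IndepFun Z W P) :
    IndepFun Z (fun ω => (X ω, W ω)) P := by
  have hXW : IndepFun X W P := hXZW.comp measurable_id measurable_snd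
  rw [indepFun_iff_map_prod_eq_prod_map_map hZ.aemeasurable (hX.prodMk hW).aemeasurable]
  refine Measure.ext_prod₃ fun {s t u} hs ht hu => ?_
  rw [Measure.map_apply (hZ.prodMk (hX.prodMk hW)) (hs.prod (ht.prod hu)), Measure.prod_prod,
    Measure.map_apply hZ hs, Measure.map_apply (hX.prodMk hW) (ht.prod hu)]
  have h1 : (fun ω => (Z ω, X ω, W ω)) ⁻¹' (s ×ˢ t ×ˢ u) =
      X ⁻¹' t ∩ (fun ω => (Z ω, W ω)) ⁻¹' (s ×ˢ u) := by
    ext ω; simp only [mem_preimage, mem_prod, mem_inter_iff]; tauto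
  have h2 : (fun ω => (Z ω, W ω)) ⁻¹' (s ×ˢ u) = Z ⁻¹' s ∩ W ⁻¹' u := rfl
  have h3 : (fun ω => (X ω, W ω)) ⁻¹' (t ×ˢ u) = X ⁻¹' t ∩ W ⁻¹' u := rfl
  rw [h1, hXZW.measure_inter_preimage_eq_mul _ _ ht (hs.prod hu), h2, h3,
    hZW.measure_inter_preimage_eq_mul _ _ hs hu, hXW.measure_inter_preimage_eq_mul _ _ ht hu]
  ring

variable {Ω : Type*} [mΩ : MeasurableSpace Ω] {n : ℕ} {P : Measure Ω}
  {T : ℝ} {σ : Matrix (Fin n) (Fin n) ℝ} {σt : ℝ → Matrix (Fin n) (Fin n) ℝ}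
  {Z W S : ℝ → Ω → E n} {β : Ω → E n}

/-- The `σ`-algebra generated by `U` and the null events. -/
@[reducible]
def augmentedComap {α : Type*} [MeasurableSpace α] (P : Measure Ω) (U : Ω → α) :
    MeasurableSpace Ω :=
  MeasurableSpace.comap U inferInstance ⊔
    MeasurableSpace.generateFrom {A | MeasurableSet A ∧ P A = 0}

theorem IsBrownianMotion.map_eq {C : Matrix (Fin n) (Fin n) ℝ} {B : ℝ → Ω → E n}
    (h : IsBrownianMotion P T C B) {t : ℝ} (ht : t ∈ Icc 0 T) :
    P.map (B t) = multivariateGaussian 0 (t • C) := by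
  have h1 := h.gaussian_increments 0 t le_rfl ht.1 ht.2
  rw [sub_zero] at h1
  rw [← h1]
  refine Measure.map_congr ?_
  filter_upwards [h.start] with ω hω
  rw [hω, sub_zero]

/-- The law of the state at time `T` is a Gaussian convolution in the first coordinate, because
`Z_T` is independent of `(β, S_T)`. -/
theorem IsMarket.exists_stateLaw_eq_conv [IsProbabilityMeasure P]
    (h : IsMarket P T σ σt Z W S β) (hT : 0 < T) :
    ∃ α : Measure (E n × E n), IsFiniteMeasure α ∧
      stateLaw P Z S β T = α ∗ liftFst (multivariateGaussian 0 (T • (σ * σ))) := by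
  have hTT : T ∈ Icc (0 : ℝ) T := ⟨hT.le, le_rfl⟩
  set F := augmentedFiltration P W h.measurable_W with hF
  -- a version of `S_T - S_0` which is measurable with respect to `W` and the null events
  set G : Ω → E n := fun ω => WithLp.toLp 2 fun i => (P[fun ω => S T ω i - S 0 ω i | F T]) ω
    with hG
  have hSG : ∀ᵐ ω ∂P, S T ω = S 0 ω + G ω := by
    have := ae_all_iff.2 fun i => (h.signal_eq i).condExp h.brownian_W h.measurable_W hTT
    filter_upwards [this] with ω hω
    ext i
    have := hω i
    simp only [hG, PiLp.add_apply]
    rw [← this]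
    ring
  set U : Ω → _ := fun ω => ((S 0 ω, β ω), fun t : Icc (0 : ℝ) T => W t ω) with hU
  have hW' : Measurable fun ω (t : Icc (0 : ℝ) T) => W t ω :=
    measurable_pi_lambda _ fun t => h.measurable_W t
  have hZ' : Measurable fun ω (t : Icc (0 : ℝ) T) => Z t ω :=
    measurable_pi_lambda _ fun t => h.measurable_Z t
  have hI : Indep (augmentedComap P U) (MeasurableSpace.comap (Z T) inferInstance) P := by
    refine indep_sup_null (mΩ := mΩ) ?_
    have h1 := indepFun_prodMk_of_indepFun (h.measurable_S_zero.prodMk h.measurable_β) hZ' hW'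
      h.indep_initial h.indep_Z_W
    have h2 : IndepFun (Z T) _ P := h1.comp (measurable_pi_apply (⟨T, hTT⟩ : Icc (0 : ℝ) T))
      measurable_id
    exact h2.symm
  have hinit : Measurable[augmentedComap P U] U :=
    (comap_measurable _).mono le_sup_left le_rfl
  have hFm : F T ≤ augmentedComap P U := by
    refine sup_le ?_ le_sup_right
    rw [iSup_comap_Icc_eq, ← measurable_iff_comap_le]
    exact measurable_snd.comp hinit
  have hGm : Measurable[augmentedComap P U] G := by
    have h1 (i) : Measurable[augmentedComap P U] (P[fun ω => S T ω i - S 0 ω i | F T]) :=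
      stronglyMeasurable_condExp.measurable.mono hFm le_rfl
    exact (WithLp.measurable_toLp 2 _).comp
      (@measurable_pi_lambda Ω (Fin n) _ (augmentedComap P U) _ _ h1)
  set X : Ω → E n × E n := fun ω => (-β ω, S 0 ω + G ω) with hX
  have hXm : Measurable[augmentedComap P U] X :=
    (measurable_neg.comp (measurable_snd.comp (measurable_fst.comp hinit))).prodMk
      ((measurable_fst.comp (measurable_fst.comp hinit)).add hGm)
  have hmle : augmentedComap P U ≤ mΩ := by
    refine sup_le ?_ (MeasurableSpace.generateFrom_le fun _ hA => hA.1)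
    exact ((h.measurable_S_zero.prodMk h.measurable_β).prodMk hW').comap_le
  have hXm' : Measurable X := hXm.mono hmle le_rfl
  have hind : IndepFun X (fun ω => (Z T ω, (0 : E n))) P := by
    have h1 : IndepFun X (Z T) P := indep_of_indep_of_le_left hI hXm.comap_le
    exact h1.comp measurable_id (measurable_id.prodMk measurable_const)
  refine ⟨P.map X, inferInstance, ?_⟩
  have h1 : stateLaw P Z S β T = P.map (X + fun ω => (Z T ω, (0 : E n))) := by
    refine Measure.map_congr ?_
    filter_upwards [hSG] with ω hω
    simp only [hX, Pi.add_apply, Prod.mk_add_mk, add_zero, ← hω]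
    congr 1
    abel
  rw [h1, hind.map_add_eq_map_conv_map₀ hXm'.aemeasurable
    ((h.measurable_Z T).prodMk measurable_const).aemeasurable, liftFst, ← h.brownian_Z.map_eq hTT,
    Measure.map_map (by fun_prop) (h.measurable_Z T)]
  rfl

end Market

/-! ### Reweighting along the transport map and choice of a simplex -/

section Reweighting

variable {n : ℕ}

/-- If the coupling `π` is concentrated on the graph of `I`, then averaging its disintegration
along the last coordinate against a reweighted marginal reweights the first marginal. -/
theorem disintegration_comp_withDensity {μ : Measure (E n × E n)} {ν : Measure (E n)}
    {π : Measure ((E n × E n) × E n)} [IsFiniteMeasure π] (hπ : π ∈ couplings μ ν)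
    {I : E n × E n → E n} (hI : Measurable I) (hgraph : ∀ᵐ p ∂π, p.2 = I p.1)
    {w : E n → ENNReal} (hw : Measurable w) :
    disintegration π ∘ₘ (ν.withDensity w) = μ.withDensity (fun x => w (I x)) := by
  obtain ⟨hfst, hsnd⟩ := hπ
  refine Measure.ext_of_lintegral _ fun f hf => ?_
  have h0 : ν ⊗ₘ disintegration π = π.map Prod.swap := by
    have h := (π.map Prod.swap).disintegrate (π.map Prod.swap).condKernel
    rwa [Measure.fst_map_swap, Measure.snd, hsnd] at h
  have hν : IsFiniteMeasure ν := by rw [← hsnd]; infer_instance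
  rw [Measure.lintegral_bind (Kernel.aemeasurable _) hf.aemeasurable,
    lintegral_withDensity_eq_lintegral_mul _ hw hf.lintegral_kernel,
    lintegral_withDensity_eq_lintegral_mul (f := fun x => w (I x)) _ (hw.comp hI) hf, ← hfst,
    lintegral_map (f := (fun x => w (I x)) * f) ((hw.comp hI).mul hf) measurable_fst]
  have h1 : ∫⁻ p, w p.1 * f p.2 ∂(ν ⊗ₘ disintegration π) =
      ∫⁻ y, (w * fun y => ∫⁻ x, f x ∂(disintegration π y)) y ∂ν := by
    rw [Measure.lintegral_compProd (by fun_prop)]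
    refine lintegral_congr fun y => ?_
    exact lintegral_const_mul (w y) hf
  rw [← h1, h0, lintegral_map (by fun_prop) measurable_swap]
  refine lintegral_congr_ae ?_
  filter_upwards [hgraph] with p hp
  simp [← hp]

/-- The likelihood ratio between `N(y, c₁ σ²)` and `N(0, c₂ σ²)`. -/
theorem map_add_multivariateGaussian {σ : Matrix (Fin n) (Fin n) ℝ} (hσ : σ.PosDef) {c₁ c₂ : ℝ}
    (hc₁ : 0 < c₁) (hc₂ : 0 < c₂) :
    ∃ C : ℝ, 0 < C ∧ ∀ y : E n, (multivariateGaussian 0 (c₁ • (σ * σ))).map (y + ·) =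
      (multivariateGaussian 0 (c₂ • (σ * σ))).withDensity fun x => ENNReal.ofReal
        (C * Real.exp (-(c₁⁻¹ / 2) *
            ‖Matrix.toEuclideanCLM (𝕜 := ℝ) σ⁻¹ x - Matrix.toEuclideanCLM (𝕜 := ℝ) σ⁻¹ y‖ ^ 2 +
          c₂⁻¹ / 2 * ‖Matrix.toEuclideanCLM (𝕜 := ℝ) σ⁻¹ x‖ ^ 2)) := by
  obtain ⟨K₁, hK₁, h₁⟩ := multivariateGaussian_eq_withDensity hσ hc₁
  obtain ⟨K₂, hK₂, h₂⟩ := multivariateGaussian_eq_withDensity hσ hc₂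
  set B : E n →L[ℝ] E n := Matrix.toEuclideanCLM (𝕜 := ℝ) σ⁻¹ with hB
  have hwhite {c : ℝ} (hc : 0 < c) (x : E n) : ‖whitening σ c x‖ ^ 2 = c⁻¹ * ‖B x‖ ^ 2 := by
    rw [whitening, _root_.smul_apply, norm_smul, mul_pow, norm_inv, Real.norm_eq_abs, inv_pow,
      sq_abs, Real.sq_sqrt hc.le]
  refine ⟨K₁ / K₂, by positivity, fun y => ?_⟩
  rw [h₁, h₂, ← withDensity_mul _ (by fun_prop) (by fun_prop)]
  refine Measure.ext_of_lintegral _ fun f hf => ?_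
  rw [lintegral_map hf (measurable_const_add y),
    lintegral_withDensity_eq_lintegral_mul _ (by fun_prop) (by fun_prop),
    lintegral_withDensity_eq_lintegral_mul _ (by fun_prop) (by fun_prop),
    ← lintegral_sub_right_eq_self _ y]
  refine lintegral_congr fun x => ?_
  simp only [Pi.mul_apply, add_sub_cancel, neg_div]
  congr 1
  rw [← ENNReal.ofReal_mul (by positivity)]
  congr 1
  have h3 := hwhite hc₁ (x - y)
  rw [map_sub B] at h3
  have h4 : Real.exp (-(‖whitening σ c₁ (x - y)‖ ^ 2 / 2)) =
      Real.exp (-(‖whitening σ c₂ x‖ ^ 2 / 2)) *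
        Real.exp (-(c₁⁻¹ / 2) * ‖B x - B y‖ ^ 2 + c₂⁻¹ / 2 * ‖B x‖ ^ 2) := by
    rw [← Real.exp_add, h3, hwhite hc₂]
    congr 1
    ring
  rw [h4]
  field_simp

/-- The inner products with the vectors of a basis are linear coordinates. -/
theorem exists_dual_coordinates {F ι : Type*} [NormedAddCommGroup F] [InnerProductSpace ℝ F]
    [FiniteDimensional ℝ F] [Fintype ι] (e : Module.Basis ι ℝ F) :
    ∃ Φ : F ≃L[ℝ] (ι → ℝ), ∀ v i, Φ v i = ⟪v, e i⟫ := by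
  set L : F →ₗ[ℝ] (ι → ℝ) := LinearMap.pi fun i => (innerₗ F (e i)) with hL
  have hLapp (v i) : L v i = ⟪v, e i⟫ := by simp [hL, real_inner_comm]
  have hinj : Function.Injective L := by
    rw [← LinearMap.ker_eq_bot, LinearMap.ker_eq_bot']
    intro v hv
    refine InnerProductSpace.ext_inner_right_basis e fun i => ?_
    rw [← hLapp, hv, inner_zero_left]
    rfl
  have hfin : Module.finrank ℝ F = Module.finrank ℝ (ι → ℝ) := by
    rw [Module.finrank_eq_card_basis e, Module.finrank_fintype_fun_eq_card]
  exact ⟨(LinearEquiv.ofInjectiveOfFinrankEq L hinj hfin).toContinuousLinearEquiv,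
    fun v i => hLapp v i⟩

/-- A property which holds almost surely for a random vector with absolutely continuous law holds
at the vertices of a nondegenerate simplex. -/
theorem exists_basis_sub_of_ae {Ω : Type*} [MeasurableSpace Ω] {P : Measure Ω}
    [IsProbabilityMeasure P] {F : Type} [NormedAddCommGroup F] [InnerProductSpace ℝ F]
    [FiniteDimensional ℝ F] [MeasurableSpace F] [BorelSpace F] {X : Ω → F} (hX : Measurable X)
    (hac : P.map X ≪ volume) {p : F → Prop} (hp : ∀ᵐ ω ∂P, p (X ω)) :
    ∃ (ι : Type) (_ : Fintype ι) (y : Option ι → F) (b : Module.Basis ι ℝ F),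
      (∀ i, p (y i)) ∧ ∀ i, b i = y (some i) - y none := by
  -- the property itself need not be measurable, but affine subspaces are
  have hspan : affineSpan ℝ {y | p y} = ⊤ := by
    by_contra h
    have h1 := hac (Measure.addHaar_affineSubspace volume _ h)
    rw [Measure.map_apply hX (AffineSubspace.closed_of_finiteDimensional _).measurableSet,
      measure_eq_zero_iff_ae_notMem] at h1
    obtain ⟨ω, hω, hω'⟩ := (h1.and hp).exists
    exact hω (subset_affineSpan ℝ {y | p y} hω')
  obtain ⟨ω₀, hω₀⟩ := hp.exists
  obtain ⟨y₀, hy₀⟩ : ∃ y, p y := ⟨X ω₀, hω₀⟩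
  have hspan' : ⊤ ≤ Submodule.span ℝ ((· -ᵥ y₀) '' {y | p y}) := by
    rw [← vectorSpan_eq_span_vsub_set_right ℝ (show y₀ ∈ {y | p y} from hy₀),
      AffineSubspace.vectorSpan_eq_top_of_affineSpan_eq_top ℝ F F hspan]
  set b := Module.Basis.ofSpan hspan' with hb
  have hmem (i) : ∃ y, p y ∧ y - y₀ = b i :=
    Module.Basis.ofSpan_subset hspan' (mem_range_self i)
  choose y hy hyb using hmem
  refine ⟨_, FiniteDimensional.fintypeBasisIndex b, fun i => i.elim y₀ y, b, ?_, fun i =>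
    (hyb i).symm⟩
  rintro (_ | i)
  exacts [hy₀, hy i]

end Reweighting

/-! ### Smooth version of the transport map -/

section Regularity

variable {n : ℕ}

/-- The regularity statement without reference to stochastic processes: it suffices that `μ` is
smoothed by `N(0, c₂ σ²)`, and that for the vertices `y i` of a nondegenerate simplex the
reweighting of `μ` by the likelihood ratio between `N(y i, c₁ σ²)` and `N(0, c₂ σ²)`, evaluated at
`I`, is a difference of finite measures smoothed by `N(0, c₁ σ²)`. -/
theorem exists_smooth_version {σ : Matrix (Fin n) (Fin n) ℝ} (hσ : σ.PosDef) {c₁ c₂ : ℝ}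
    (hc₁ : 0 < c₁) (hlt : c₁ < c₂) {μ α : Measure (E n × E n)} [IsFiniteMeasure α]
    (hμ : μ = α ∗ liftFst (multivariateGaussian 0 (c₂ • (σ * σ)))) {I : E n × E n → E n}
    (hI : Measurable I) {C : ℝ} (hC : 0 < C) {ι : Type*} [Fintype ι] {y : Option ι → E n}
    {b : Module.Basis ι ℝ (E n)} (hb : ∀ i, b i = y (some i) - y none)
    (hy : ∀ i, ∃ α₁ α₂ : Measure (E n × E n), IsFiniteMeasure α₁ ∧ IsFiniteMeasure α₂ ∧
      μ.withDensity (fun x => ENNReal.ofReal (C * Real.exp (-(c₁⁻¹ / 2) *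
            ‖Matrix.toEuclideanCLM (𝕜 := ℝ) σ⁻¹ (I x) -
              Matrix.toEuclideanCLM (𝕜 := ℝ) σ⁻¹ (y i)‖ ^ 2 +
          c₂⁻¹ / 2 * ‖Matrix.toEuclideanCLM (𝕜 := ℝ) σ⁻¹ (I x)‖ ^ 2))) +
        α₁ ∗ liftFst (multivariateGaussian 0 (c₁ • (σ * σ))) =
      α₂ ∗ liftFst (multivariateGaussian 0 (c₁ • (σ * σ)))) :
    ∃ J : E n × E n → E n, Measurable J ∧ I =ᵐ[μ] J ∧
      ∀ s : E n, ContDiff ℝ (⊤ : ℕ∞) (fun z => J (z, s)) := by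
  have hc₂ : 0 < c₂ := hc₁.trans hlt
  set A : E n →L[ℝ] E n := Matrix.toEuclideanCLM (𝕜 := ℝ) σ with hA
  set B : E n →L[ℝ] E n := Matrix.toEuclideanCLM (𝕜 := ℝ) σ⁻¹ with hB
  have hdet : IsUnit σ.det := hσ.det_pos.ne'.isUnit
  have hAB (x) : A (B x) = x := toEuclideanCLM_apply_inv_apply hdet x
  have hBA (x) : B (A x) = x := toEuclideanCLM_inv_apply_apply hdet x
  set η : Option ι → E n := fun i => B (y i) with hη
  set Be : E n ≃ₗ[ℝ] E n := LinearEquiv.ofLinearMap (B : E n →ₗ[ℝ] E n) (A : E n →ₗ[ℝ] E n)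
    (by ext1 x; exact hBA x) (by ext1 x; exact hAB x) with hBe
  obtain ⟨Φ, hΦ⟩ := exists_dual_coordinates (b.map Be)
  replace hΦ : ∀ v i, Φ v i = ⟪v, η (some i) - η none⟫ := fun v i => by
    rw [hΦ, hη, Module.Basis.map_apply, hb]
    simp only [← map_sub]
    rfl
  choose α₁ α₂ hα₁ hα₂ heq using hy
  obtain ⟨K₁, hK₁, h₁⟩ := multivariateGaussian_eq_withDensity hσ hc₁
  obtain ⟨K₂, hK₂, h₂⟩ := multivariateGaussian_eq_withDensity hσ hc₂
  -- index `none` stands for `μ`, `some (i, r)` for the two parts of the `i`-th measure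
  set fam : Option (Option ι × Bool) → Measure (E n × E n) :=
    fun j => j.elim α fun p => if p.2 then α₂ p.1 else α₁ p.1 with hfam
  set cov : Option (Option ι × Bool) → ℝ := fun j => j.elim c₂ fun _ => c₁ with hcov
  have hfin (j) : IsFiniteMeasure (fam j) := by
    rcases j with _ | ⟨i, _ | _⟩
    exacts [‹IsFiniteMeasure α›, hα₁ i, hα₂ i]
  obtain ⟨lam, h, hlam, hm, hprof, hdens⟩ := exists_smooth_densities fam
    (M := fun j => whitening σ (cov j)) (K := fun j => j.elim K₂ fun _ => K₁)
    (N := fun j => multivariateGaussian 0 (cov j • (σ * σ)))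
    (by rintro (_ | _); exacts [hK₂, hK₁]) (by rintro (_ | _); exacts [h₂, h₁])
  set q : E n × E n → ℝ := h none with hq
  have hqm : Measurable q := hm none
  have hq0 (x) : 0 ≤ q x := by
    rcases (hprof none x.2).zero_or_pos with h0 | h0
    exacts [(h0 x.1).ge, (h0 x.1).le]
  have hh0 (j x) : 0 ≤ h j x := by
    rcases (hprof j x.2).zero_or_pos with h0 | h0
    exacts [(h0 x.1).ge, (h0 x.1).le]
  have hμq : μ = (volume.prod lam).withDensity fun x => ENNReal.ofReal (q x) :=
    hμ.trans (hdens none)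
  set g : Option ι → E n × E n → ℝ := fun i x => h (some (i, true)) x - h (some (i, false)) x
    with hg
  have hgm (i) : Measurable (g i) := (hm _).sub (hm _)
  set w : Option ι → E n × E n → ℝ := fun i x => C * Real.exp (-(c₁⁻¹ / 2) *
    ‖B (I x) - η i‖ ^ 2 + c₂⁻¹ / 2 * ‖B (I x)‖ ^ 2) with hw
  have hwm (i) : Measurable (w i) := by fun_prop
  have hw0 (i x) : 0 ≤ w i x := by positivity
  have hgae (i) : ∀ᵐ x ∂(volume.prod lam), g i x = w i x * q x := by
    have h3 : μ.withDensity (fun x => ENNReal.ofReal (w i x)) +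
        (volume.prod lam).withDensity (fun x => ENNReal.ofReal (h (some (i, false)) x)) =
        (volume.prod lam).withDensity (fun x => ENNReal.ofReal (h (some (i, true)) x)) := by
      rw [← hdens (some (i, false)), ← hdens (some (i, true))]
      exact heq i
    rw [hμq, ← withDensity_mul _ (by fun_prop) (by fun_prop),
      ← withDensity_add_left (by fun_prop),
      withDensity_eq_iff_of_sigmaFinite (by fun_prop) (by fun_prop)] at h3
    filter_upwards [h3] with x hx
    simp only [Pi.add_apply, Pi.mul_apply] at hx
    rw [← ENNReal.ofReal_mul (hq0 x), ← ENNReal.ofReal_add (mul_nonneg (hq0 x) (hw0 i x)) (hh0 _ _),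
      ENNReal.ofReal_eq_ofReal_iff (add_nonneg (mul_nonneg (hq0 x) (hw0 i x)) (hh0 _ _))
        (hh0 _ _)] at hx
    simp only [hg, ← hx]
    ring
  -- the exceptional `lam`-null set of fibres
  have hgood : ∀ᵐ s ∂lam, ∀ᵐ z, ∀ i, g i (z, s) = w i (z, s) * q (z, s) := by
    have h3 : ∀ᵐ x ∂(lam.prod (volume : Measure (E n))),
        ∀ i, g i x.swap = w i x.swap * q x.swap := by
      have h4 := ae_all_iff.2 hgae
      rw [← Measure.prod_swap] at h4
      exact ae_of_ae_map measurable_swap.aemeasurable h4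
    exact Measure.ae_ae_of_ae_prod h3
  set bad : Set (E n) := toMeasurable lam {s | ∀ᵐ z, ∀ i, g i (z, s) = w i (z, s) * q (z, s)}ᶜ
    with hbad
  have hbadm : MeasurableSet bad := measurableSet_toMeasurable _ _
  have hbad0 : lam bad = 0 := by rw [hbad, measure_toMeasurable]; exact hgood
  have hnotbad {s} (hs : s ∉ bad) : ∀ᵐ z, ∀ i, g i (z, s) = w i (z, s) * q (z, s) := by
    by_contra h5
    exact hs (subset_toMeasurable _ _ h5)
  have hfibre {s} (hs : s ∉ bad) (hpos : ∀ z, 0 < q (z, s)) :=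
    pos_and_eq_decode_of_ae_eq (a := c₁⁻¹) (b := c₂⁻¹) (C := C) (inv_pos.2 hc₁)
      (inv_strictAnti₀ hc₁ hlt) hC hΦ (q := fun z => q (z, s)) (hprof none s).contDiff.continuous
      hpos (g := fun i z => g i (z, s))
      (fun i => (hprof _ s).contDiff.continuous.sub (hprof _ s).contDiff.continuous)
      (fun i z d τ => ((hprof _ s).analyticAt_line z d τ).sub ((hprof _ s).analyticAt_line z d τ))
      (v := fun z => B (I (z, s))) (hnotbad hs)
  set J₀ : E n × E n → E n := fun x => A (decode Φ c₁⁻¹ η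
    fun i => Real.log (g (some i) x) - Real.log (g none x)) with hJ₀
  have hJ₀m : Measurable J₀ := by
    refine A.measurable.comp ((contDiff_decode Φ c₁⁻¹ η).continuous.measurable.comp
      (measurable_pi_lambda _ fun i => ?_))
    exact (hgm _).log.sub (hgm _).log
  set good : Set (E n) := badᶜ ∩ {s | 0 < q (0, s)} with hgoodset
  have hgoodm : MeasurableSet good :=
    hbadm.compl.inter (measurableSet_lt measurable_const (by fun_prop))
  have hqpos {s z} (hz : 0 < q (z, s)) : ∀ z', 0 < q (z', s) :=
    (hprof none s).zero_or_pos.resolve_left fun h6 => hz.ne' (h6 z)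
  refine ⟨(Prod.snd ⁻¹' good).indicator J₀, hJ₀m.indicator (measurable_snd hgoodm), ?_,
    fun s => ?_⟩
  · have h6 : MeasurableSet {x | q x ≠ 0 → I x = (Prod.snd ⁻¹' good).indicator J₀ x} := by
      have h7 : MeasurableSet {x | I x = (Prod.snd ⁻¹' good).indicator J₀ x} :=
        measurableSet_eq_fun hI (hJ₀m.indicator (measurable_snd hgoodm))
      exact (measurableSet_eq_fun hqm measurable_const).compl.imp h7
    rw [hμq, EventuallyEq, ae_withDensity_iff (by fun_prop)]
    have h8 : ∀ᵐ x ∂(volume.prod lam), q x ≠ 0 → I x = (Prod.snd ⁻¹' good).indicator J₀ x := by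
      rw [← Measure.prod_swap, ae_map_iff measurable_swap.aemeasurable h6]
      refine (Measure.ae_prod_iff_ae_ae (measurable_swap h6)).2 ?_
      have hbad' : ∀ᵐ s ∂lam, s ∉ bad := measure_eq_zero_iff_ae_notMem.1 hbad0
      filter_upwards [hbad'] with s hs
      by_cases hpos : 0 < q (0, s)
      · filter_upwards [(hfibre hs (hqpos hpos)).2] with z hz _
        have hmem : (z, s) ∈ Prod.snd ⁻¹' good := ⟨hs, hpos⟩
        rw [Prod.swap_prod_mk, indicator_of_mem hmem]
        simp only [hJ₀]
        rw [← hz, hAB]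
      · refine ae_of_all _ fun z hz => absurd ?_ hpos
        exact hqpos ((hq0 _).lt_of_ne' hz) 0
    filter_upwards [h8] with x hx hx0
    exact hx fun h9 => hx0 (by rw [h9, ENNReal.ofReal_zero])
  · by_cases hs : s ∈ good
    · have h7 : (fun z => (Prod.snd ⁻¹' good).indicator J₀ (z, s)) = fun z => J₀ (z, s) := by
        ext1 z
        exact indicator_of_mem (show (z, s) ∈ Prod.snd ⁻¹' good from hs) _
      have h8 := (hfibre hs.1 (hqpos hs.2)).1
      rw [h7]
      have h9 (i) : ContDiff ℝ (⊤ : ℕ∞) fun z => Real.log (g i (z, s)) :=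
        ((hprof _ s).contDiff.sub (hprof _ s).contDiff).log fun z => (h8 i z).ne'
      exact A.contDiff.comp ((contDiff_decode Φ c₁⁻¹ η).comp
        (contDiff_pi.2 fun i => (h9 _).sub (h9 _)))
    · have h7 : (fun z => (Prod.snd ⁻¹' good).indicator J₀ (z, s)) = fun _ => 0 := by
        ext1 z
        exact indicator_of_notMem (show (z, s) ∉ Prod.snd ⁻¹' good from hs) _
      rw [h7]
      exact contDiff_const

end Regularity

end Kyle

end

theorem mainTheorem6 {Ω Ω' : Type*} [MeasurableSpace Ω] [MeasurableSpace Ω']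
    (P : MeasureTheory.Measure Ω) [MeasureTheory.IsProbabilityMeasure P]
    (P' : MeasureTheory.Measure Ω') [MeasureTheory.IsProbabilityMeasure P']
    (n : ℕ) (hn : 1 ≤ n) (T : ℝ) (hT : 0 < T)
    -- the market
    (σ : Matrix (Fin n) (Fin n) ℝ) (σt : ℝ → Matrix (Fin n) (Fin n) ℝ)
    (Z W S : ℝ → Ω → Kyle.E n) (β : Ω → Kyle.E n)
    (hmarket : Kyle.IsMarket P T σ σt Z W S β)
    -- the optimal transport problem between the law of `(Z_T - β, S_T)` and the law of `Z_T`
    (V : Kyle.E n × Kyle.E n → ℝ) (Γ : Kyle.E n → ℝ) (Γc : Kyle.E n × Kyle.E n → ℝ)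
    (I : Kyle.E n × Kyle.E n → Kyle.E n)
    (π : MeasureTheory.Measure ((Kyle.E n × Kyle.E n) × Kyle.E n))
    [MeasureTheory.IsProbabilityMeasure π]
    (hOT : Kyle.IsOptimalTransport V (Kyle.stateLaw P Z S β T) (P.map (Z T)) Γ Γc I π)
    -- a solution of the BSPDE driven by some `σ²`-Brownian motion `Y`
    (Y : ℝ → Ω' → Kyle.E n) (hYmeas : ∀ t, Measurable (Y t))
    (hY : Kyle.IsBrownianMotion P' T (σ * σ) Y)
    (ρ : ℝ → Ω' → MeasureTheory.SignedMeasure (Kyle.E n × Kyle.E n))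
    (R : (Kyle.E n × Kyle.E n → ℝ) → ℝ → Ω' → Kyle.E n)
    (hρ : Kyle.IsBSPDESolution P' (Kyle.augmentedFiltration P' Y hYmeas) T σ σt Y
      (Kyle.disintegration π) ρ R)
    -- the law of `(-β, S_0)` has a smooth density
    (hμ₀ : Kyle.HasSmoothDensity (P.map (fun ω => (-β ω, S 0 ω)))) :
    ∃ J : Kyle.E n × Kyle.E n → Kyle.E n, Measurable J ∧
      I =ᵐ[Kyle.stateLaw P Z S β T] J ∧
      ∀ s : Kyle.E n, ContDiff ℝ (⊤ : ℕ∞) (fun z => J (z, s)) := by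
  have hσ := hmarket.vol_posDef
  have hpsd : (σ * σ).PosSemidef := by
    have := Matrix.posSemidef_conjTranspose_mul_self σ
    rwa [hσ.isHermitian.eq] at this
  -- any intermediate time would do
  set t : ℝ := T / 2 with ht
  have htT : t ∈ Icc 0 T := ⟨by positivity, by linarith⟩
  have hc₁ : 0 < T - t := by linarith
  have hlt : T - t < T := by linarith
  have hconv := hρ.conv_eq hpsd hY hYmeas hmarket.signal_posSemidef hmarket.signal_memLp htT
  set N := multivariateGaussian 0 ((T - t) • (σ * σ)) with hN
  set Q := multivariateGaussian 0 (Kyle.signalCov σt t T) with hQ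
  set good : Kyle.E n → Prop := fun y => ∃ α₁ α₂ : Measure (Kyle.E n × Kyle.E n),
    IsFiniteMeasure α₁ ∧ IsFiniteMeasure α₂ ∧
      Kyle.disintegration π ∘ₘ N.map (y + ·) + α₁ ∗ Kyle.liftFst N = α₂ ∗ Kyle.liftFst N with hgood
  have hYgood : ∀ᵐ ω ∂P', good (Y t ω) := by
    filter_upwards [hconv] with ω hω
    have hassoc (α : Measure (Kyle.E n × Kyle.E n)) [IsFiniteMeasure α] :
        α ∗ (Kyle.liftFst N ∗ Kyle.liftSnd Q) = (α ∗ Kyle.liftSnd Q) ∗ Kyle.liftFst N := by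
      rw [Measure.conv_comm (Kyle.liftFst N), Measure.conv_assoc]
    rw [hassoc, hassoc] at hω
    exact ⟨_, _, inferInstance, inferInstance, hω⟩
  have hac : P'.map (Y t) ≪ volume := by
    obtain ⟨K, -, hK⟩ := Kyle.multivariateGaussian_eq_withDensity hσ (c := t) (by positivity)
    rw [hY.map_eq htT, hK]
    exact withDensity_absolutelyContinuous _ _
  obtain ⟨ι, _, y, b, hy, hb⟩ := Kyle.exists_basis_sub_of_ae (hYmeas t) hac hYgood
  obtain ⟨α, _, hα⟩ := hmarket.exists_stateLaw_eq_conv hT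
  obtain ⟨C, hC, hlik⟩ := Kyle.map_add_multivariateGaussian hσ hc₁ hT
  refine Kyle.exists_smooth_version hσ hc₁ hlt hα hOT.measurable_map hC hb fun i => ?_
  obtain ⟨α₁, α₂, h₁, h₂, h⟩ := hy i
  refine ⟨α₁, α₂, h₁, h₂, ?_⟩
  rw [← h, hN, hlik, ← hmarket.brownian_Z.map_eq ⟨hT.le, le_rfl⟩,
    Kyle.disintegration_comp_withDensity hOT.coupling hOT.measurable_map hOT.graph (by fun_prop)]
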